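/- Fix $n\ge 3$, an $n$-dimensional real vector space $E$ and a basis $e_1,\dots,e_n$ of $E$, and let $L=\mathbb Z e_1+\dots+\mathbb Z e_n$. A convex polytope is the convex hull of a nonempty finite set; its faces are the polytope itself and its nonempty intersections with supporting hyperplanes; it is a lattice polytope if all its vertices lie in $L$. A lattice-affine transformation is an invertible affine map $g:E\to E$ with $g(L)=L$; two polytopes are lattice-congruent if some lattice-affine transformation takes one to the other. A face-flag of a $d$-dimensional polytope $P$ is a chain of faces $F_0\subset F_1\subset\dots\subset F_d=P$ with $\dim F_i=i$; a lattice polytope $P$ is lattice-regular if for any two of its face-flags there is a lattice-affine transformation preserving $P$ and taking the first flag to the second. A lattice polytope is elementary if for no integer $t>1$ and no lattice polytope $Q$ it is lattice-congruent to $tQ=\{tx : x\in Q\}$. An $n$-dimensional generalized octahedron is a convex polytope that is combinatorially isomorphic (by an inclusion- and dimension-preserving bijection of faces) to the regular cross-polytope $\operatorname{conv}\{\pm\epsilon_1,\dots,\pm\epsilon_n\}\subset\mathbb R^n$, where $\epsilon_1,\dots,\epsilon_n$ is the standard basis. Denote by $\{3^{n-2},4\}^L_1$, $\{3^{n-2},4\}^L_2$,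 $\{3^{n-2},4\}^L_3$ the convex hulls of, respectively, 1. $\pm e_i$ for $1\le i\le n$; 2. $\pm e_i$ for $1\le i\le n-1$, and $\pm(e_1+\dots+e_{n-1}+2e_n)$; 3. $0$, $-e_1$, and $-e_1-e_i$, $e_i$ for $2\le i\le n$. Then every elementary lattice-regular $n$-dimensional lattice generalized octahedron in $E$ is lattice-congruent to $\{3^{n-2},4\}^L_1$, $\{3^{n-2},4\}^L_2$ or $\{3^{n-2},4\}^L_3$. These three polytopes are lattice-regular $n$-dimensional lattice generalized octahedra, and no two of them are lattice-congruent to each other. -/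

import Mathlib

namespace LatticePolytope

variable {E F : Type*} [NormedAddCommGroup E] [NormedSpace ℝ E]
  [NormedAddCommGroup F] [NormedSpace ℝ F]

/-- A convex polytope: the convex hull of a nonempty finite set of points. -/
def IsPolytope (P : Set E) : Prop :=
  ∃ S : Set E, S.Finite ∧ S.Nonempty ∧ P = convexHull ℝ S

/-- A (nonempty) face of `P`: the set where some linear functional attains its maximum on `P`.
A nonzero functional gives the intersection of `P` with a supporting hyperplane,
the zero functional gives `P` itself. -/
def IsFace (P G : Set E) : Prop :=
  G.Nonempty ∧ IsExposed ℝ P G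

/-- The dimension of a polytope: the dimension of its affine hull. -/
noncomputable def dim (P : Set E) : ℕ :=
  Module.finrank ℝ (vectorSpan ℝ P)

/-- A face-flag of an `n`-dimensional polytope `P`: faces `G 0 ⊆ G 1 ⊆ ⋯ ⊆ G n = P`
with `dim (G i) = i`. -/
structure IsFaceFlag (P : Set E) (n : ℕ) (G : Fin (n + 1) → Set E) : Prop where
  top : G (Fin.last n) = P
  face : ∀ i, IsFace P (G i)
  dim_eq : ∀ i, dim (G i) = (i : ℕ)
  mono : Monotone G

/-- Combinatorial isomorphism of polytopes: a bijection between the faces that preserves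
inclusions (in both directions) and dimensions. -/
def CombIso (P : Set E) (Q : Set F) : Prop :=
  ∃ φ : {G : Set E // IsFace P G} ≃o {H : Set F // IsFace Q H},
    ∀ G, dim (φ G : Set F) = dim (G : Set E)

/-- The regular Euclidean generalized octahedron (cross-polytope) of dimension `n`. -/
def stdCrossPolytope (n : ℕ) : Set (EuclideanSpace ℝ (Fin n)) :=
  convexHull ℝ {x | ∃ i, x = EuclideanSpace.single i 1 ∨ x = -EuclideanSpace.single i 1}

/-- An `n`-dimensional generalized octahedron: a convex polytope combinatorially isomorphic to the
regular Euclidean generalized octahedron. -/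
def IsGenOctahedron (n : ℕ) (P : Set E) : Prop :=
  IsPolytope P ∧ CombIso P (stdCrossPolytope n)

/-- The full-rank lattice generated by a basis. -/
def lattice {n : ℕ} (e : Module.Basis (Fin n) ℝ E) : Set E :=
  (Submodule.span ℤ (Set.range e) : Submodule ℤ E)

/-- A convex polytope all of whose vertices (zero-dimensional faces) are points of `L`. -/
def IsLatticePolytope (L : Set E) (P : Set E) : Prop :=
  IsPolytope P ∧ ∀ v, IsFace P {v} → v ∈ L

/-- An affine transformation preserving `L`. -/
def IsLatticeAffine (L : Set E) (g : E ≃ᵃ[ℝ] E) : Prop :=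
  g '' L = L

/-- Lattice-congruence. -/
def LatticeCongruent (L : Set E) (P Q : Set E) : Prop :=
  ∃ g : E ≃ᵃ[ℝ] E, IsLatticeAffine L g ∧ g '' P = Q

/-- `P` is lattice-regular: any face-flag of `P` can be taken to any other one by
a lattice-affine transformation preserving `P`. -/
def IsLatticeRegular (L : Set E) (P : Set E) : Prop :=
  ∀ (n : ℕ) (G H : Fin (n + 1) → Set E), IsFaceFlag P n G → IsFaceFlag P n H →
    ∃ g : E ≃ᵃ[ℝ] E, IsLatticeAffine L g ∧ g '' P = P ∧ ∀ i, g '' (G i) = H i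

/-- The `t`-multiple of `Q`. -/
def multiple (t : ℕ) (Q : Set E) : Set E :=
  (fun x => (t : ℝ) • x) '' Q

/-- `P` is elementary: it is not lattice-congruent to a `t`-multiple, `t > 1`, of a lattice
polytope. -/
def IsElementary (L : Set E) (P : Set E) : Prop :=
  ∀ t : ℕ, 1 < t → ∀ Q : Set E, IsLatticePolytope L Q → ¬ LatticeCongruent L P (multiple t Q)

/-- Vertices `± e₁, …, ± eₙ`. -/
def oct₁ {n : ℕ} (e : Module.Basis (Fin n) ℝ E) : Set E :=
  convexHull ℝ {x | ∃ i, x = e i ∨ x = -e i}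

/-- The vector `e₁ + ⋯ + eₙ₋₁ + 2 eₙ` (indices in `Fin n` start at `0`). -/
noncomputable def apex {n : ℕ} (e : Module.Basis (Fin n) ℝ E) : E :=
  ∑ i : Fin n, (if (i : ℕ) + 1 = n then (2 : ℝ) else 1) • e i

/-- Vertices `± e₁, …, ± eₙ₋₁` and `± (e₁ + ⋯ + eₙ₋₁ + 2 eₙ)`. -/
def oct₂ {n : ℕ} (e : Module.Basis (Fin n) ℝ E) : Set E :=
  convexHull ℝ ({x | ∃ i : Fin n, (i : ℕ) + 1 < n ∧ (x = e i ∨ x = -e i)} ∪ {apex e, -apex e})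

/-- Vertices `0`, `-e₁`, and `-e₁ - eᵢ`, `eᵢ` for `i = 2, …, n` (here `o`, the index of `e₁`,
has value `0`). -/
def oct₃ {n : ℕ} (e : Module.Basis (Fin n) ℝ E) : Set E :=
  convexHull ℝ {x | x = 0 ∨ ∃ o : Fin n, (o : ℕ) = 0 ∧
    (x = -e o ∨ ∃ i : Fin n, i ≠ o ∧ (x = -e o - e i ∨ x = e i))}

end LatticePolytope

/-! Face-flags of a cross-polytope are orderings of the coordinates together with signs. For a
lattice-regular generalized octahedron `P`, flag-transitivity therefore realizes every signed
permutation of the vertex labels by a lattice-affine map (`exists_isRegularLabelling`). Sign flips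
then act on the diagonals with eigenvalues ±1, which makes the diagonals independent and gives them
a common midpoint. So `P` is an affine cross-polytope `cross c f`
(`IsRegularLabelling.exists_frame`).

In the coordinates of `f` the lattice becomes a subgroup `M` of ℝⁿ invariant under signed
permutations. Being elementary normalizes the scale: b(ε₁ - ε₂) lies in `M` exactly for integral b.
Only three such groups exist (`eq_of_signedPermInvariant`): ℤⁿ, ℤⁿ together with its translate by
(½, …, ½), and the integer vectors of even sum. Since `c + f o` is a lattice point while `c` need
not be, the affine coordinates of the lattice form `M` shifted by a unit vector. The shift changes
only the third group, into the vectors of odd sum (`lattice_eq_frameSet`).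

The set of lattice coordinates is a complete congruence invariant: equal sets give congruent
polytopes (`latticeCongruent_of_frames`), and congruent polytopes have equal sets
(`eq_of_latticeCongruent`). Each model realizes one of the three sets, and invariance of these sets
under signed permutations gives regularity (`isLatticeRegular_cross`). -/

namespace LatticePolytope

/-! ### Faces of polytopes and their affine invariance -/

section Faces

variable {E F : Type*} [NormedAddCommGroup E] [NormedSpace ℝ E]
  [NormedAddCommGroup F] [NormedSpace ℝ F]

theorem IsFace.subset {P G : Set E} (h : IsFace P G) : G ⊆ P := h.2.subset

theorem isFace_self {P : Set E} (h : P.Nonempty) : IsFace P P :=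
  ⟨h, IsExposed.refl P⟩

/-- A face of the convex hull of a finite set is spanned by the generators it contains. -/
theorem IsFace.eq_convexHull {S G : Set E} (hS : S.Finite) (h : IsFace (convexHull ℝ S) G) :
    G = convexHull ℝ (S ∩ G) := by
  have hc : IsCompact (convexHull ℝ S) := (hS.isCompact_convexHull (𝕜 := ℝ))
  have hG : IsCompact G := h.2.isCompact hc
  have hGc : Convex ℝ G := h.2.convex (convex_convexHull ℝ S)
  apply subset_antisymm
  · have hsub : G.extremePoints ℝ ⊆ S ∩ G := fun x hx =>
      ⟨extremePoints_convexHull_subset (h.2.isExtreme.extremePoints_subset_extremePoints hx),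
        hx.1⟩
    -- Krein–Milman; the closure is harmless because the hull of a finite set is already closed.
    conv_lhs => rw [← closure_convexHull_extremePoints hG hGc]
    refine closure_minimal ?_ ?_
    · exact convexHull_mono hsub
    · exact ((hS.inter_of_left G).isCompact_convexHull (𝕜 := ℝ)).isClosed
  · exact convexHull_min Set.inter_subset_right hGc

theorem mem_of_isFace_singleton {S : Set E} {v : E} (h : IsFace (convexHull ℝ S) {v}) : v ∈ S := by
  apply extremePoints_convexHull_subset (𝕜 := ℝ)
  exact isExtreme_singleton.1 h.2.isExtreme

/-- The hull of the other generators is compact and misses `v`, so a functional separates it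
strictly from `v` and is maximal only there. -/
theorem isFace_singleton_of_mem_extremePoints {S : Set E} (hS : S.Finite) {v : E}
    (h : v ∈ (convexHull ℝ S).extremePoints ℝ) : IsFace (convexHull ℝ S) {v} := by
  have hvS : v ∈ S := extremePoints_convexHull_subset h
  have hv : v ∉ convexHull ℝ (S \ {v}) := by
    intro hv
    have h1 := (convex_convexHull ℝ S).mem_extremePoints_iff_mem_sdiff_convexHull_sdiff.1 h
    exact h1.2 (convexHull_mono (Set.sdiff_subset_sdiff_left (subset_convexHull ℝ S)) hv)
  obtain ⟨l, u, hlu, hu⟩ := geometric_hahn_banach_closed_point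
    (convex_convexHull ℝ (S \ {v})) ((hS.sdiff.isCompact_convexHull (𝕜 := ℝ)).isClosed) hv
  have hle : ∀ y ∈ S, y ≠ v → l y < l v := fun y hy hyv =>
    (hlu y (subset_convexHull ℝ _ ⟨hy, hyv⟩)).trans hu
  have hmax : ∀ y ∈ convexHull ℝ S, l y ≤ l v := by
    intro y hy
    refine convexHull_min (t := {y | l y ≤ l v}) ?_ ?_ hy
    · intro y hy
      by_cases hyv : y = v
      · simp [hyv]
      · exact (hle y hy hyv).le
    · exact convex_halfSpace_le l.toLinearMap.isLinear _
  have hexp : IsExposed ℝ (convexHull ℝ S) {x ∈ convexHull ℝ S | ∀ y ∈ convexHull ℝ S, l y ≤ l x} :=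
    fun _ => ⟨l, rfl⟩
  have hmem : v ∈ {x ∈ convexHull ℝ S | ∀ y ∈ convexHull ℝ S, l y ≤ l x} :=
    ⟨subset_convexHull ℝ S hvS, hmax⟩
  have heq : {x ∈ convexHull ℝ S | ∀ y ∈ convexHull ℝ S, l y ≤ l x} = {v} := by
    rw [IsFace.eq_convexHull hS ⟨⟨v, hmem⟩, hexp⟩]
    have : S ∩ {x ∈ convexHull ℝ S | ∀ y ∈ convexHull ℝ S, l y ≤ l x} = {v} := by
      ext y
      constructor
      · rintro ⟨hy, -, hy2⟩
        by_contra hyv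
        exact absurd (hle y hy hyv) (not_lt.2 (hy2 v (subset_convexHull ℝ S hvS)))
      · rintro rfl
        exact ⟨hvS, hmem⟩
    rw [this, convexHull_singleton]
  exact ⟨Set.singleton_nonempty v, heq ▸ hexp⟩

/-- A polytope is the convex hull of its vertices. -/
theorem IsPolytope.eq_convexHull_vertices {P : Set E} (h : IsPolytope P) :
    P = convexHull ℝ {v | IsFace P {v}} := by
  obtain ⟨S, hS, -, rfl⟩ := h
  have hsub : {v | IsFace (convexHull ℝ S) {v}} ⊆ S := fun v hv => mem_of_isFace_singleton hv
  apply subset_antisymm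
  · conv_lhs => rw [← closure_convexHull_extremePoints (hS.isCompact_convexHull (𝕜 := ℝ))
      (convex_convexHull ℝ S)]
    refine closure_minimal ?_ ((hS.subset hsub).isCompact_convexHull (𝕜 := ℝ)).isClosed
    exact convexHull_mono fun v hv => isFace_singleton_of_mem_extremePoints hS hv
  · exact convexHull_mono hsub

theorem IsPolytope.nonempty {P : Set E} (h : IsPolytope P) : P.Nonempty := by
  obtain ⟨S, -, hS, rfl⟩ := h
  exact hS.convexHull

theorem IsFace.image [FiniteDimensional ℝ E] [FiniteDimensional ℝ F] {P G : Set E}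
    (g : E ≃ᵃ[ℝ] F) (h : IsFace P G) : IsFace (g '' P) (g '' G) := by
  refine ⟨h.1.image g, fun _ => ?_⟩
  obtain ⟨l, hl⟩ := h.2 h.1
  refine ⟨l.comp (LinearMap.toContinuousLinearMap g.linear.symm.toLinearMap), ?_⟩
  -- The translation part of `g` adds the same constant on both sides.
  have key : ∀ x y : E, l (g.linear.symm (g x)) ≤ l (g.linear.symm (g y)) ↔ l x ≤ l y := by
    intro x y
    have hx : ∀ x, g.linear.symm (g x) = x + g.linear.symm (g 0) := by
      intro x
      apply g.linear.injective
      have := g.map_vadd 0 x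
      simp only [vadd_eq_add, add_zero] at this
      simp [this]
    rw [hx x, hx y]
    simp
  subst hl
  ext z
  constructor
  · rintro ⟨x, ⟨hxP, hx⟩, rfl⟩
    refine ⟨⟨x, hxP, rfl⟩, ?_⟩
    rintro _ ⟨y, hy, rfl⟩
    exact (key y x).2 (hx y hy)
  · rintro ⟨⟨x, hxP, rfl⟩, hx⟩
    exact ⟨x, ⟨hxP, fun y hy => (key y x).1 (hx _ ⟨y, hy, rfl⟩)⟩, rfl⟩

theorem isFace_image_iff [FiniteDimensional ℝ E] [FiniteDimensional ℝ F] {P G : Set E}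
    (g : E ≃ᵃ[ℝ] F) : IsFace (g '' P) (g '' G) ↔ IsFace P G := by
  refine ⟨fun h => ?_, fun h => h.image g⟩
  have := h.image g.symm
  simpa [Set.image_image] using this

theorem dim_image (g : E ≃ᵃ[ℝ] F) (G : Set E) : dim (g '' G) = dim G := by
  have : vectorSpan ℝ (g '' G) = (vectorSpan ℝ G).map g.linear.toLinearMap := by
    have := (g : E →ᵃ[ℝ] F).map_vectorSpan (s := G)
    simpa using this.symm
  rw [dim, this, dim]
  exact LinearEquiv.finrank_map_eq g.linear _

theorem dim_singleton (v : E) : dim ({v} : Set E) = 0 := by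
  simp [dim]

theorem dim_convexHull (S : Set E) : dim (convexHull ℝ S) = dim S := by
  rw [dim, ← direction_affineSpan, affineSpan_convexHull, direction_affineSpan, dim]

theorem exists_eq_singleton_of_dim_eq_zero [FiniteDimensional ℝ E] {G : Set E} (hG : G.Nonempty)
    (h : dim G = 0) : ∃ v, G = {v} := by
  obtain ⟨v, hv⟩ := hG
  refine ⟨v, Set.eq_singleton_iff_unique_mem.2 ⟨hv, fun w hw => ?_⟩⟩
  have h0 : vectorSpan ℝ G = ⊥ := Submodule.finrank_eq_zero.1 h
  have : w -ᵥ v ∈ vectorSpan ℝ G := vsub_mem_vectorSpan ℝ hw hv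
  rw [h0, Submodule.mem_bot, vsub_eq_sub, sub_eq_zero] at this
  exact this

/-- Affinely equivalent polytopes are combinatorially isomorphic. -/
theorem combIso_image [FiniteDimensional ℝ E] [FiniteDimensional ℝ F] (g : E ≃ᵃ[ℝ] F)
    (P : Set E) : CombIso (g '' P) P := by
  have hcancel : ∀ H : Set F, g '' (g.symm '' H) = H := fun H => by
    rw [Set.image_image]
    simp only [AffineEquiv.apply_symm_apply, Set.image_id']
  refine ⟨⟨⟨fun H => ⟨g.symm '' (H : Set F), ?_⟩, fun G => ⟨g '' (G : Set E), G.2.image g⟩, ?_, ?_⟩,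
    ?_⟩, ?_⟩
  · rw [← isFace_image_iff g, hcancel]
    exact H.2
  · intro H
    exact Subtype.ext (hcancel _)
  · intro G
    simp [Set.image_image]
  · intro H K
    exact Set.image_subset_image_iff g.symm.injective
  · intro H
    exact dim_image g.symm _

end Faces

/-! ### Faces and flags of cross-polytopes -/

section Cross

variable {E : Type*} [NormedAddCommGroup E] [NormedSpace ℝ E] {n : ℕ}

/-- The vertex `c ± f i` of the cross-polytope with centre `c` and half-diagonals `f`. -/
def crossVertex (c : E) (f : Fin n → E) (x : Fin n × ℤˣ) : E :=
  c + ((x.2 : ℤ) : ℝ) • f x.1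

/-- The cross-polytope with centre `c` and half-diagonals `f`. -/
def cross (c : E) (f : Fin n → E) : Set E :=
  convexHull ℝ (Set.range (crossVertex c f))

/-- The convex hull of the vertices `c + s i • f i` with `i ∈ T`. -/
def subface (c : E) (f : Fin n → E) (T : Finset (Fin n)) (s : Fin n → ℤˣ) : Set E :=
  convexHull ℝ ((fun i => crossVertex c f (i, s i)) '' T)

theorem crossVertex_mem_cross (c : E) (f : Fin n → E) (x : Fin n × ℤˣ) :
    crossVertex c f x ∈ cross c f :=
  subset_convexHull ℝ _ ⟨x, rfl⟩

theorem crossVertex_injective (c : E) (f : Module.Basis (Fin n) ℝ E) :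
    Function.Injective (crossVertex c f) := by
  rintro ⟨i, u⟩ ⟨j, v⟩ h
  have h' : ((u : ℤ) : ℝ) • f i = ((v : ℤ) : ℝ) • f j := add_left_cancel h
  have hu := congrArg (fun x => f.repr x i) h'
  have hij : i = j := by
    by_contra hij
    rcases Int.units_eq_one_or u with rfl | rfl <;>
      simp [Ne.symm hij] at hu
  subst hij
  simp only [map_smul, Module.Basis.repr_self, Finsupp.smul_single, smul_eq_mul, mul_one,
    Finsupp.single_eq_same, Int.cast_inj] at hu
  rw [Units.ext hu]

/-- The functional that is maximal exactly on `subface c f T s`. -/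
noncomputable def subfaceFunctional (f : Module.Basis (Fin n) ℝ E) (T : Finset (Fin n))
    (s : Fin n → ℤˣ) : E →ₗ[ℝ] ℝ :=
  ∑ i ∈ T, ((s i : ℤ) : ℝ) • f.coord i

theorem subfaceFunctional_crossVertex (c : E) (f : Module.Basis (Fin n) ℝ E)
    (T : Finset (Fin n)) (s : Fin n → ℤˣ) (x : Fin n × ℤˣ) :
    subfaceFunctional f T s (crossVertex c f x) = subfaceFunctional f T s c +
      if x.1 ∈ T then (((s x.1 * x.2 : ℤˣ) : ℤ) : ℝ) else 0 := by
  rw [crossVertex, map_add]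
  congr 1
  simp only [subfaceFunctional, LinearMap.sum_apply, LinearMap.smul_apply, map_smul,
    Module.Basis.coord_apply, Module.Basis.repr_self, smul_eq_mul, Finsupp.single_apply]
  simp only [mul_ite, mul_one, mul_zero, Finset.sum_ite_eq, Units.val_mul, Int.cast_mul,
    mul_comm]

theorem intUnit_cast_le_one (u : ℤˣ) : ((u : ℤ) : ℝ) ≤ 1 := by
  rcases Int.units_eq_one_or u with rfl | rfl <;> norm_num

theorem intUnit_mul_eq_one {u v : ℤˣ} : u * v = 1 ↔ u = v := by
  rw [mul_eq_one_iff_eq_inv, Int.units_inv_eq_self]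

theorem subfaceFunctional_crossVertex_le (c : E) (f : Module.Basis (Fin n) ℝ E)
    (T : Finset (Fin n)) (s : Fin n → ℤˣ) (x : Fin n × ℤˣ) :
    subfaceFunctional f T s (crossVertex c f x) ≤ subfaceFunctional f T s c + 1 := by
  rw [subfaceFunctional_crossVertex]
  gcongr
  split_ifs
  · exact intUnit_cast_le_one _
  · norm_num

/-- No vertex exceeds this value, so the inequality singles out the maximizers; this form also
defines a convex half-space. -/
theorem subfaceFunctional_crossVertex_eq_iff (c : E) (f : Module.Basis (Fin n) ℝ E)
    (T : Finset (Fin n)) (s : Fin n → ℤˣ) (x : Fin n × ℤˣ) :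
    subfaceFunctional f T s c + 1 ≤ subfaceFunctional f T s (crossVertex c f x) ↔
      x.1 ∈ T ∧ s x.1 = x.2 := by
  rw [subfaceFunctional_crossVertex, add_le_add_iff_left]
  split_ifs with h
  · rw [← intUnit_mul_eq_one (u := s x.1)]
    rcases Int.units_eq_one_or (s x.1 * x.2) with h' | h' <;> rw [h'] <;> norm_num [h]
  · norm_num [h]

theorem crossVertex_mem_subface_iff (c : E) (f : Module.Basis (Fin n) ℝ E)
    (T : Finset (Fin n)) (s : Fin n → ℤˣ) (x : Fin n × ℤˣ) :
    crossVertex c f x ∈ subface c f T s ↔ x.1 ∈ T ∧ s x.1 = x.2 := by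
  constructor
  · intro h
    rw [← subfaceFunctional_crossVertex_eq_iff c f]
    refine convexHull_min (t := {y | subfaceFunctional f T s c + 1 ≤ subfaceFunctional f T s y})
      ?_ (convex_halfSpace_ge (subfaceFunctional f T s).isLinear _) h
    rintro _ ⟨i, hi, rfl⟩
    exact (subfaceFunctional_crossVertex_eq_iff c f T s (i, s i)).2 ⟨hi, rfl⟩
  · rintro ⟨h, h'⟩
    exact subset_convexHull ℝ _ ⟨x.1, h, by simp [h']⟩

theorem finite_range_crossVertex (c : E) (f : Fin n → E) :
    (Set.range (crossVertex c f)).Finite :=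
  Set.finite_range _

theorem isFace_subface (c : E) (f : Module.Basis (Fin n) ℝ E)
    {T : Finset (Fin n)} (hT : T.Nonempty) (s : Fin n → ℤˣ) :
    IsFace (cross c f) (subface c f T s) := by
  have : FiniteDimensional ℝ E := Module.Finite.of_basis f
  set l := subfaceFunctional f T s with hl
  set G : Set E := {x ∈ cross c f | ∀ y ∈ cross c f, l y ≤ l x} with hG
  have hexp : IsExposed ℝ (cross c f) G := fun _ => ⟨LinearMap.toContinuousLinearMap l, rfl⟩
  have hle : ∀ y ∈ cross c f, l y ≤ l c + 1 := by
    intro y hy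
    refine convexHull_min (t := {y | l y ≤ l c + 1}) ?_ (convex_halfSpace_le l.isLinear _) hy
    rintro _ ⟨x, rfl⟩
    exact subfaceFunctional_crossVertex_le c f T s x
  obtain ⟨i₀, hi₀⟩ := hT
  have hi : l c + 1 ≤ l (crossVertex c f (i₀, s i₀)) :=
    (subfaceFunctional_crossVertex_eq_iff c f T s (i₀, s i₀)).2 ⟨hi₀, rfl⟩
  have hmem : ∀ x, crossVertex c f x ∈ G ↔ x.1 ∈ T ∧ s x.1 = x.2 := by
    intro x
    rw [← subfaceFunctional_crossVertex_eq_iff c f]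
    exact ⟨fun h => hi.trans (h.2 _ (crossVertex_mem_cross c f _)),
      fun h => ⟨crossVertex_mem_cross c f x, fun y hy => (hle y hy).trans h⟩⟩
  have hface : IsFace (cross c f) G := ⟨⟨_, (hmem (i₀, s i₀)).2 ⟨hi₀, rfl⟩⟩, hexp⟩
  suffices h : G = subface c f T s from h ▸ hface
  rw [hface.eq_convexHull (finite_range_crossVertex c f), subface]
  congr 1
  ext y
  constructor
  · rintro ⟨⟨x, rfl⟩, hx⟩
    obtain ⟨h1, h2⟩ := (hmem x).1 hx
    exact ⟨x.1, h1, by simp [h2]⟩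
  · rintro ⟨i, hi, rfl⟩
    exact ⟨⟨_, rfl⟩, (hmem (i, s i)).2 ⟨hi, rfl⟩⟩

theorem crossVertex_eq_of_isFace {c : E} {f : Fin n → E} {v : E}
    (h : IsFace (cross c f) {v}) : ∃ x, crossVertex c f x = v :=
  mem_of_isFace_singleton (S := Set.range (crossVertex c f)) h

theorem subface_singleton (c : E) (f : Fin n → E) (i : Fin n) (s : Fin n → ℤˣ) :
    subface c f {i} s = {crossVertex c f (i, s i)} := by
  simp [subface]

theorem isFace_crossVertex (c : E) (f : Module.Basis (Fin n) ℝ E) (x : Fin n × ℤˣ) :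
    IsFace (cross c f) {crossVertex c f x} := by
  have := isFace_subface c f (Finset.singleton_nonempty x.1) (fun _ => x.2)
  rwa [subface_singleton] at this

theorem dim_cross (c : E) (f : Module.Basis (Fin n) ℝ E) : dim (cross c f) = n := by
  rw [cross, dim_convexHull, dim]
  have h : vectorSpan ℝ (Set.range (crossVertex c f)) = ⊤ := by
    rw [eq_top_iff, ← f.span_eq, Submodule.span_le]
    rintro _ ⟨i, rfl⟩
    have := vsub_mem_vectorSpan ℝ (s := Set.range (crossVertex c f)) ⟨(i, 1), rfl⟩ ⟨(i, -1), rfl⟩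
    have h2 := Submodule.smul_mem _ (2⁻¹ : ℝ) this
    have h3 : (2⁻¹ : ℝ) • (crossVertex c f (i, 1) -ᵥ crossVertex c f (i, -1)) = f i := by
      simp only [crossVertex, vsub_eq_sub, Units.val_one, Int.cast_one, one_smul, Units.val_neg,
        Int.cast_neg, neg_smul]
      module
    rwa [h3] at h2
  rw [h, finrank_top, Module.finrank_eq_card_basis f, Fintype.card_fin]

theorem affineIndependent_crossVertex (c : E) (f : Module.Basis (Fin n) ℝ E) (s : Fin n → ℤˣ) :
    AffineIndependent ℝ (fun i => crossVertex c f (i, s i)) := by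
  rw [affineIndependent_iff_of_fintype]
  intro w hw hs i
  rw [Finset.weightedVSub_eq_weightedVSubOfPoint_of_sum_eq_zero _ _ _ hw c,
    Finset.weightedVSubOfPoint_apply] at hs
  simp only [crossVertex, vsub_eq_sub, add_sub_cancel_left, smul_smul] at hs
  have := Fintype.linearIndependent_iff.1 f.linearIndependent _ hs i
  rcases Int.units_eq_one_or (s i) with h | h <;> rw [h] at this <;> simpa using this

theorem dim_subface (c : E) (f : Module.Basis (Fin n) ℝ E) {T : Finset (Fin n)}
    (hT : T.Nonempty) (s : Fin n → ℤˣ) : dim (subface c f T s) + 1 = T.card := by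
  classical
  obtain ⟨k, hk⟩ := Nat.exists_eq_succ_of_ne_zero hT.card_pos.ne'
  rw [subface, dim_convexHull, dim, hk, ← Finset.coe_image,
    (affineIndependent_crossVertex c f s).finrank_vectorSpan_image_finset hk]

/-- A functional maximal at two antipodes has its maximum at the centre as well. Then no
half-diagonal can increase or decrease it, so it is constant. -/
theorem cross_subset_of_antipodes {c : E} {f : Fin n → E} {G : Set E}
    (hG : IsFace (cross c f) G) {i : Fin n} (h₁ : crossVertex c f (i, 1) ∈ G)
    (h₂ : crossVertex c f (i, -1) ∈ G) : G = cross c f := by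
  obtain ⟨l, rfl⟩ := hG.2 hG.1
  refine subset_antisymm (fun x hx => hx.1) fun x hx => ⟨hx, ?_⟩
  have a1 := h₁.2 _ h₂.1
  have a2 := h₂.2 _ h₁.1
  have b := fun y => h₁.2 _ (crossVertex_mem_cross c f y)
  simp only [crossVertex, map_add, map_smul, smul_eq_mul, Units.val_one, Units.val_neg,
    Int.cast_one, Int.cast_neg] at a1 a2 b
  have hi : l (f i) = 0 := by linarith
  have hj : ∀ j, l (f j) = 0 := by
    intro j
    have b1 := b (j, 1)
    have b2 := b (j, -1)
    simp only [Units.val_one, Units.val_neg, Int.cast_one, Int.cast_neg] at b1 b2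
    linarith
  have hconst : ∀ y ∈ cross c f, l y = l c := by
    intro y hy
    refine convexHull_min (t := {y | l y = l c}) ?_ (convex_hyperplane l.toLinearMap.isLinear _) hy
    rintro _ ⟨x, rfl⟩
    simp [crossVertex, hj]
  intro y hy
  rw [hconst y hy, hconst x hx]

/-- The proper faces of a cross-polytope are the hulls of sets of vertices without antipodes. -/
theorem exists_eq_subface {c : E} {f : Fin n → E} {G : Set E}
    (hG : IsFace (cross c f) G) (hne : G ≠ cross c f) :
    ∃ (T : Finset (Fin n)) (s : Fin n → ℤˣ), T.Nonempty ∧ G = subface c f T s := by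
  classical
  have hanti : ∀ i, crossVertex c f (i, 1) ∈ G → crossVertex c f (i, -1) ∉ G := fun i h₁ h₂ =>
    hne (cross_subset_of_antipodes hG h₁ h₂)
  let T : Finset (Fin n) := {i | ∃ u, crossVertex c f (i, u) ∈ G}
  -- Outside `T` the sign `-1` is a dummy value; `subface` reads signs only on `T`.
  let s : Fin n → ℤˣ := fun i => if crossVertex c f (i, 1) ∈ G then 1 else -1
  have hs : ∀ i u, crossVertex c f (i, u) ∈ G ↔ i ∈ T ∧ s i = u := by
    intro i u
    simp only [T, s, Finset.mem_filter, Finset.mem_univ, true_and]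
    have := hanti i
    constructor
    · intro h
      refine ⟨⟨u, h⟩, ?_⟩
      rcases Int.units_eq_one_or u with rfl | rfl
      · simp [h]
      · rw [if_neg (fun h1 => this h1 h)]
    · rintro ⟨⟨v, hv⟩, rfl⟩
      split_ifs with h
      · exact h
      · rcases Int.units_eq_one_or v with rfl | rfl
        · exact absurd hv h
        · exact hv
  have heq : G = subface c f T s := by
    conv_lhs => rw [hG.eq_convexHull (finite_range_crossVertex c f)]
    rw [subface]
    congr 1
    ext y
    constructor
    · rintro ⟨⟨⟨i, u⟩, rfl⟩, hx⟩
      obtain ⟨h1, h2⟩ := (hs i u).1 hx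
      exact ⟨i, h1, by simp [h2]⟩
    · rintro ⟨i, hi, rfl⟩
      exact ⟨⟨_, rfl⟩, (hs i (s i)).2 ⟨hi, rfl⟩⟩
  refine ⟨T, s, ?_, heq⟩
  have h := hG.1
  rw [heq, subface, convexHull_nonempty_iff] at h
  exact Finset.coe_nonempty.1 (Set.image_nonempty.1 h)

theorem subface_ne_cross (c : E) (f : Module.Basis (Fin n) ℝ E) {T : Finset (Fin n)}
    (hT : T.Nonempty) (s : Fin n → ℤˣ) : subface c f T s ≠ cross c f := by
  intro h
  obtain ⟨i, -⟩ := hT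
  have h₁ := crossVertex_mem_cross c f (i, -s i)
  rw [← h, crossVertex_mem_subface_iff] at h₁
  rcases Int.units_eq_one_or (s i) with h' | h' <;> simp [h'] at h₁

theorem subface_subset_subface_iff (c : E) (f : Module.Basis (Fin n) ℝ E) {T T' : Finset (Fin n)}
    {s s' : Fin n → ℤˣ} : subface c f T s ⊆ subface c f T' s' ↔ T ⊆ T' ∧ ∀ i ∈ T, s' i = s i := by
  constructor
  · intro h
    have key : ∀ i ∈ T, i ∈ T' ∧ s' i = s i := fun i hi =>
      (crossVertex_mem_subface_iff c f T' s' (i, s i)).1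
        (h ((crossVertex_mem_subface_iff c f T s (i, s i)).2 ⟨hi, rfl⟩))
    exact ⟨fun i hi => (key i hi).1, fun i hi => (key i hi).2⟩
  · rintro ⟨h, hs⟩
    refine convexHull_mono ?_
    rintro _ ⟨i, hi, rfl⟩
    exact ⟨i, h hi, by simp only [hs i hi]⟩

theorem subface_congr (c : E) (f : Fin n → E) {T : Finset (Fin n)} {s s' : Fin n → ℤˣ}
    (h : ∀ i ∈ T, s i = s' i) : subface c f T s = subface c f T s' := by
  rw [subface, subface]
  congr 1
  exact Set.image_congr fun i hi => by rw [h i hi]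

theorem subface_subset_cross (c : E) (f : Fin n → E) (T : Finset (Fin n)) (s : Fin n → ℤˣ) :
    subface c f T s ⊆ cross c f := by
  refine convexHull_mono ?_
  rintro _ ⟨i, -, rfl⟩
  exact ⟨_, rfl⟩

/-- The first `k + 1` coordinates in the order given by `π`. -/
def initialSegment (π : Equiv.Perm (Fin n)) (k : ℕ) : Finset (Fin n) :=
  {i | (π.symm i : ℕ) ≤ k}

theorem mem_initialSegment {π : Equiv.Perm (Fin n)} {k : ℕ} {i : Fin n} :
    i ∈ initialSegment π k ↔ (π.symm i : ℕ) ≤ k := by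
  simp [initialSegment]

theorem initialSegment_nonempty (π : Equiv.Perm (Fin n)) {k : ℕ} (hk : k < n) :
    (initialSegment π k).Nonempty :=
  ⟨π ⟨k, hk⟩, by simp [mem_initialSegment]⟩

theorem card_initialSegment (π : Equiv.Perm (Fin n)) {k : ℕ} (hk : k < n) :
    (initialSegment π k).card = k + 1 := by
  have : initialSegment π k = (Finset.Iic (⟨k, hk⟩ : Fin n)).map π.toEmbedding := by
    ext i
    simp [mem_initialSegment, Finset.mem_map_equiv, Fin.le_def]
  rw [this, Finset.card_map, Fin.card_Iic]

/-- The members of the flag attached to an ordering `π` of the coordinates and signs `s`. -/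
def flag (c : E) (f : Fin n → E) (π : Equiv.Perm (Fin n)) (s : Fin n → ℤˣ) (k : Fin (n + 1)) :
    Set E :=
  if (k : ℕ) < n then subface c f (initialSegment π k) s else cross c f

theorem isFaceFlag_flag (hn : 0 < n) (c : E) (f : Module.Basis (Fin n) ℝ E)
    (π : Equiv.Perm (Fin n)) (s : Fin n → ℤˣ) : IsFaceFlag (cross c f) n (flag c f π s) where
  top := by simp [flag]
  face k := by
    rw [flag]
    split_ifs with hk
    · exact isFace_subface c f (initialSegment_nonempty π hk) s
    · exact isFace_self ⟨_, crossVertex_mem_cross c f (⟨0, hn⟩, 1)⟩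
  dim_eq k := by
    rw [flag]
    split_ifs with hk
    · have := dim_subface c f (initialSegment_nonempty π hk) s
      rw [card_initialSegment π hk] at this
      exact Nat.succ_injective this
    · rw [dim_cross]
      have := k.2
      lia
  mono := by
    intro k l hkl
    have hkl' : (k : ℕ) ≤ l := hkl
    by_cases hl : (l : ℕ) < n
    · rw [flag, flag, if_pos hl, if_pos (hkl'.trans_lt hl), subface_subset_subface_iff]
      exact ⟨fun i hi => mem_initialSegment.2 ((mem_initialSegment.1 hi).trans hkl'),
        fun _ _ => rfl⟩
    · rw [flag, flag, if_neg hl]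
      split_ifs
      · exact subface_subset_cross c f _ _
      · exact subset_rfl

theorem IsFaceFlag.dim_eq_length {P : Set E} {m : ℕ} {G : Fin (m + 1) → Set E}
    (h : IsFaceFlag P m G) : dim P = m := by
  rw [← h.top, h.dim_eq, Fin.val_last]

/-- A chain of finsets of cardinalities `1, …, n` comes from an ordering. -/
theorem exists_eq_initialSegment (T : Fin n → Finset (Fin n)) (hT : Monotone T)
    (hcard : ∀ k, (T k).card = k + 1) :
    ∃ π : Equiv.Perm (Fin n), ∀ k, T k = initialSegment π k := by
  -- Each set has one element more than its predecessor; the new elements, in order of appearance,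
  -- form the permutation.
  have hex : ∀ k : Fin n, ∃ a ∈ T k, ∀ j < k, a ∉ T j := by
    rintro ⟨k, hk⟩
    rcases k with _ | k
    · obtain ⟨a, ha⟩ : (T ⟨0, hk⟩).Nonempty := by
        rw [← Finset.card_pos, hcard]
        lia
      exact ⟨a, ha, fun j hj => absurd (Fin.lt_def.1 hj) (by simp)⟩
    · have hlt : (T ⟨k, by lia⟩).card < (T ⟨k + 1, hk⟩).card := by
        rw [hcard, hcard]
        simp
      obtain ⟨a, ha, ha'⟩ := Finset.exists_mem_notMem_of_card_lt_card hlt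
      exact ⟨a, ha, fun j hj haj => ha' (hT (Fin.le_def.2 (Nat.lt_succ_iff.1 hj)) haj)⟩
  choose p hp hp' using hex
  have hinj : Function.Injective p := by
    intro j k hjk
    rcases lt_trichotomy j k with h | h | h
    · exact absurd (hjk ▸ hp j) (hp' k j h)
    · exact h
    · exact absurd (hjk ▸ hp k) (hp' j k h)
  refine ⟨Equiv.ofBijective p (Finite.injective_iff_bijective.1 hinj), fun k => ?_⟩
  refine (Finset.eq_of_subset_of_card_le (fun i hi => ?_) ?_).symm
  · have hi' := mem_initialSegment.1 hi
    set π := Equiv.ofBijective p (Finite.injective_iff_bijective.1 hinj) with hπ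
    have hmem : π (π.symm i) ∈ T (π.symm i) := hp (π.symm i)
    rw [Equiv.apply_symm_apply] at hmem
    exact hT hi' hmem
  · rw [hcard, card_initialSegment _ k.2]

theorem IsFaceFlag.exists_eq_flag {c : E} {f : Module.Basis (Fin n) ℝ E}
    {G : Fin (n + 1) → Set E} (h : IsFaceFlag (cross c f) n G) :
    ∃ (π : Equiv.Perm (Fin n)) (s : Fin n → ℤˣ), G = flag c f π s := by
  have hex : ∀ k : Fin n, ∃ (T : Finset (Fin n)) (s : Fin n → ℤˣ),
      T.Nonempty ∧ G k.castSucc = subface c f T s := fun k =>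
    exists_eq_subface (h.face k.castSucc) fun heq => by
      have := h.dim_eq k.castSucc
      rw [heq, dim_cross, Fin.val_castSucc] at this
      exact k.2.ne' this
  choose T s hT hG using hex
  have hcard : ∀ k, (T k).card = k + 1 := by
    intro k
    rw [← dim_subface c f (hT k) (s k), ← hG k, h.dim_eq, Fin.val_castSucc]
  have hle : ∀ j k, j ≤ k → T j ⊆ T k ∧ ∀ i ∈ T j, s k i = s j i := by
    intro j k hjk
    rw [← subface_subset_subface_iff c f, ← hG, ← hG]
    exact h.mono (Fin.castSucc_le_castSucc_iff.2 hjk)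
  obtain ⟨π, hπ⟩ := exists_eq_initialSegment T (fun j k hjk => (hle j k hjk).1) hcard
  rcases Nat.eq_zero_or_pos n with hn | hn
  · subst hn
    refine ⟨1, 1, ?_⟩
    funext k
    refine Fin.lastCases ?_ (fun k => k.elim0) k
    rw [h.top]
    simp [flag]
  · refine ⟨π, s ⟨n - 1, by lia⟩, ?_⟩
    funext k
    refine Fin.lastCases ?_ (fun k => ?_) k
    · rw [h.top]
      simp [flag]
    · rw [hG k, flag, Fin.val_castSucc, if_pos k.2, ← hπ]
      exact subface_congr c f fun i hi =>
        ((hle k _ (Fin.le_def.2 (Nat.le_sub_one_of_lt k.2))).2 i hi).symm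

end Cross

/-! ### Lattice coordinates in an affine frame; regularity and congruence -/

section Frames

variable {E F : Type*} [NormedAddCommGroup E] [NormedSpace ℝ E]
  [NormedAddCommGroup F] [NormedSpace ℝ F] {n : ℕ}

/-- The affine equivalence taking the frame `(c, f)` to the frame `(c', f')`. -/
noncomputable def frameEquiv (c : E) (f : Module.Basis (Fin n) ℝ E) (c' : F)
    (f' : Module.Basis (Fin n) ℝ F) : E ≃ᵃ[ℝ] F :=
  ((AffineEquiv.constVAdd ℝ E (-c)).trans (f.equiv f' (Equiv.refl _)).toAffineEquiv).trans
    (AffineEquiv.constVAdd ℝ F c')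

theorem frameEquiv_apply (c : E) (f : Module.Basis (Fin n) ℝ E) (c' : F)
    (f' : Module.Basis (Fin n) ℝ F) (x : E) :
    frameEquiv c f c' f' (c + x) = c' + f.equiv f' (Equiv.refl _) x := by
  simp [frameEquiv]

theorem frameEquiv_sum (c : E) (f : Module.Basis (Fin n) ℝ E) (c' : F)
    (f' : Module.Basis (Fin n) ℝ F) (a : Fin n → ℝ) :
    frameEquiv c f c' f' (c + ∑ i, a i • f i) = c' + ∑ i, a i • f' i := by
  simp [frameEquiv_apply]

theorem frameEquiv_crossVertex (c : E) (f : Module.Basis (Fin n) ℝ E) (c' : F)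
    (f' : Module.Basis (Fin n) ℝ F) (x : Fin n × ℤˣ) :
    frameEquiv c f c' f' (crossVertex c f x) = crossVertex c' f' x := by
  simp [crossVertex, frameEquiv_apply]

theorem image_cross (g : E ≃ᵃ[ℝ] F) {c : E} {f : Fin n → E} {c' : F} {f' : Fin n → F}
    (h : ∀ x, g (crossVertex c f x) = crossVertex c' f' x) : g '' cross c f = cross c' f' := by
  have := (g : E →ᵃ[ℝ] F).image_convexHull (Set.range (crossVertex c f))
  rw [AffineEquiv.coe_toAffineMap, ← Set.range_comp] at this
  rw [cross, this, cross]
  congr 2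
  exact funext h

theorem isPolytope_cross (hn : 0 < n) (c : E) (f : Fin n → E) : IsPolytope (cross c f) :=
  ⟨_, finite_range_crossVertex c f, ⟨_, ⟨(⟨0, hn⟩, 1), rfl⟩⟩, rfl⟩

theorem exists_stdCrossPolytope_eq (n : ℕ) :
    ∃ b : Module.Basis (Fin n) ℝ (EuclideanSpace ℝ (Fin n)), stdCrossPolytope n = cross 0 b := by
  refine ⟨(EuclideanSpace.basisFun (Fin n) ℝ).toBasis, ?_⟩
  rw [stdCrossPolytope, cross]
  congr 1
  ext x
  simp only [Set.mem_ofPred_eq, Set.mem_range, Prod.exists, crossVertex, zero_add]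
  refine exists_congr fun i => ⟨?_, ?_⟩
  · rintro (rfl | rfl)
    · exact ⟨1, by simp⟩
    · exact ⟨-1, by simp⟩
  · rintro ⟨u, rfl⟩
    rcases Int.units_eq_one_or u with rfl | rfl
    · left
      simp
    · right
      simp

theorem isGenOctahedron_cross (hn : 0 < n) (c : E) (f : Module.Basis (Fin n) ℝ E) :
    IsGenOctahedron n (cross c f) := by
  have : FiniteDimensional ℝ E := Module.Finite.of_basis f
  obtain ⟨b, hb⟩ := exists_stdCrossPolytope_eq n
  refine ⟨isPolytope_cross hn c f, ?_⟩
  rw [hb, ← image_cross _ (frameEquiv_crossVertex 0 b c f)]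
  exact combIso_image _ _

theorem isLatticePolytope_cross (hn : 0 < n) {L : Set E} {c : E} {f : Fin n → E}
    (h : ∀ x, crossVertex c f x ∈ L) : IsLatticePolytope L (cross c f) := by
  refine ⟨isPolytope_cross hn c f, fun v hv => ?_⟩
  obtain ⟨x, rfl⟩ := crossVertex_eq_of_isFace hv
  exact h x

/-- The set of points whose coordinate vectors in the frame `(c, f)` lie in `A`. -/
def frameSet (c : E) (f : Fin n → E) (A : Set (Fin n → ℝ)) : Set E :=
  (fun a : Fin n → ℝ => c + ∑ i, a i • f i) '' A

theorem frameSet_injective (c : E) (f : Module.Basis (Fin n) ℝ E) :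
    Function.Injective (frameSet c f) := by
  refine Function.Injective.image_injective fun a b h => ?_
  have h' := add_left_cancel h
  rw [← f.equivFun_symm_apply, ← f.equivFun_symm_apply] at h'
  exact f.equivFun.symm.injective h'

theorem image_frameSet (g : E ≃ᵃ[ℝ] F) {c : E} {f : Fin n → E} {c' : F} {f' : Fin n → F}
    (h : ∀ a : Fin n → ℝ, g (c + ∑ i, a i • f i) = c' + ∑ i, a i • f' i)
    (A : Set (Fin n → ℝ)) : g '' frameSet c f A = frameSet c' f' A := by
  rw [frameSet, Set.image_image, frameSet]
  exact Set.image_congr fun a _ => h a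

/-- Invariance of a set of coordinate vectors under signed permutations. -/
def SignedPermInvariant (A : Set (Fin n → ℝ)) : Prop :=
  ∀ (ρ : Equiv.Perm (Fin n)) (t : Fin n → ℤˣ), ∀ a ∈ A,
    (fun i => ((t i : ℤ) : ℝ) * a (ρ i)) ∈ A

/-- The basis of vectors `t i • f (ρ i)`. -/
noncomputable def signedBasis (f : Module.Basis (Fin n) ℝ E) (ρ : Equiv.Perm (Fin n))
    (t : Fin n → ℤˣ) : Module.Basis (Fin n) ℝ E :=
  (f.reindex ρ.symm).unitsSMul fun i => Units.map (Int.castRingHom ℝ).toMonoidHom (t i)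

theorem signedBasis_apply (f : Module.Basis (Fin n) ℝ E) (ρ : Equiv.Perm (Fin n))
    (t : Fin n → ℤˣ) (i : Fin n) : signedBasis f ρ t i = ((t i : ℤ) : ℝ) • f (ρ i) := by
  simp [signedBasis, Module.Basis.unitsSMul_apply, Units.smul_def]

theorem frameSet_signed_subset {A : Set (Fin n → ℝ)} (hA : SignedPermInvariant A) (c : E)
    (f f' : Fin n → E) (ρ : Equiv.Perm (Fin n)) (t : Fin n → ℤˣ)
    (h : ∀ i, f' i = ((t i : ℤ) : ℝ) • f (ρ i)) : frameSet c f' A ⊆ frameSet c f A := by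
  rintro _ ⟨a, ha, rfl⟩
  refine ⟨_, hA ρ.symm (fun i => t (ρ.symm i)) a ha, ?_⟩
  simp only [h]
  congr 1
  rw [← Equiv.sum_comp ρ]
  simp [smul_smul, mul_comm]

theorem intUnit_cast_mul_self (u : ℤˣ) : ((u : ℤ) : ℝ) * ((u : ℤ) : ℝ) = 1 := by
  rcases Int.units_eq_one_or u with rfl | rfl <;> norm_num

theorem frameSet_signed {A : Set (Fin n → ℝ)} (hA : SignedPermInvariant A) (c : E)
    (f f' : Fin n → E) (ρ : Equiv.Perm (Fin n)) (t : Fin n → ℤˣ)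
    (h : ∀ i, f' i = ((t i : ℤ) : ℝ) • f (ρ i)) : frameSet c f' A = frameSet c f A := by
  refine subset_antisymm (frameSet_signed_subset hA c f f' ρ t h)
    (frameSet_signed_subset hA c f' f ρ.symm (fun i => t (ρ.symm i)) fun i => ?_)
  rw [h, smul_smul, Equiv.apply_symm_apply, intUnit_cast_mul_self, one_smul]

theorem crossVertex_signed (c : E) (f f' : Fin n → E) (ρ : Equiv.Perm (Fin n)) (t : Fin n → ℤˣ)
    (h : ∀ i, f' i = ((t i : ℤ) : ℝ) • f (ρ i)) (x : Fin n × ℤˣ) :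
    crossVertex c f' x = crossVertex c f (ρ x.1, t x.1 * x.2) := by
  simp [crossVertex, h, smul_smul, mul_comm]

theorem cross_signed (c : E) (f f' : Fin n → E) (ρ : Equiv.Perm (Fin n)) (t : Fin n → ℤˣ)
    (h : ∀ i, f' i = ((t i : ℤ) : ℝ) • f (ρ i)) : cross c f' = cross c f := by
  rw [cross, cross]
  congr 1
  ext y
  constructor
  · rintro ⟨x, rfl⟩
    exact ⟨_, (crossVertex_signed c f f' ρ t h x).symm⟩
  · rintro ⟨⟨i, u⟩, rfl⟩
    refine ⟨(ρ.symm i, t (ρ.symm i) * u), ?_⟩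
    rw [crossVertex_signed c f f' ρ t h]
    simp only [Equiv.apply_symm_apply, ← mul_assoc, Int.units_mul_self, one_mul]

/-- The affine map from one frame to the other preserves coordinates, hence preserves `L`. -/
theorem latticeCongruent_of_frames {L : Set E} {A : Set (Fin n → ℝ)} {c c' : E}
    {f f' : Module.Basis (Fin n) ℝ E} (h : L = frameSet c f A) (h' : L = frameSet c' f' A) :
    LatticeCongruent L (cross c f) (cross c' f') := by
  refine ⟨frameEquiv c f c' f', ?_, image_cross _ (frameEquiv_crossVertex c f c' f')⟩
  rw [IsLatticeAffine]
  conv_lhs => rw [h]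
  rw [image_frameSet _ (frameEquiv_sum c f c' f'), ← h']

/-- Two flags differ by a signed permutation of the frame, and invariance of `A` makes the
corresponding affine map preserve `L`. -/
theorem isLatticeRegular_cross {L : Set E} {A : Set (Fin n → ℝ)} (hA : SignedPermInvariant A)
    {c : E} {f : Module.Basis (Fin n) ℝ E} (h : L = frameSet c f A) :
    IsLatticeRegular L (cross c f) := by
  intro m G H hG hH
  obtain rfl : n = m := by rw [← hG.dim_eq_length, dim_cross]
  obtain ⟨π, s, rfl⟩ := hG.exists_eq_flag
  obtain ⟨π', s', rfl⟩ := hH.exists_eq_flag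
  let ρ : Equiv.Perm (Fin n) := π.symm.trans π'
  -- Chosen so that `t i * s i = s' (ρ i)`: the vertex `(i, s i)` must go to `(ρ i, s' (ρ i))`.
  let t : Fin n → ℤˣ := fun i => s i * s' (ρ i)
  let f' := signedBasis f ρ t
  have hf' : ∀ i, f' i = ((t i : ℤ) : ℝ) • f (ρ i) := signedBasis_apply f ρ t
  have hcross : frameEquiv c f c f' '' cross c f = cross c f := by
    rw [image_cross _ (frameEquiv_crossVertex c f c f'), cross_signed c f f' ρ t hf']
  refine ⟨frameEquiv c f c f', ?_, hcross, fun k => ?_⟩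
  · rw [IsLatticeAffine, h, image_frameSet _ (frameEquiv_sum c f c f'),
      frameSet_signed hA c f f' ρ t hf']
  · rw [flag, flag]
    split_ifs with hk
    · have := (frameEquiv c f c f' : E →ᵃ[ℝ] E).image_convexHull
        ((fun i => crossVertex c f (i, s i)) '' initialSegment π k)
      rw [AffineEquiv.coe_toAffineMap] at this
      rw [subface, this, subface, Set.image_image]
      congr 1
      have hv : ∀ i, frameEquiv c f c f' (crossVertex c f (i, s i)) =
          crossVertex c f (ρ i, s' (ρ i)) := by
        intro i
        rw [frameEquiv_crossVertex, crossVertex_signed c f f' ρ t hf']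
        simp only [t, mul_comm (s i), mul_assoc, Int.units_mul_self, mul_one]
      simp only [hv]
      ext y
      constructor
      · rintro ⟨i, hi, rfl⟩
        refine ⟨ρ i, ?_, rfl⟩
        simpa [mem_initialSegment, ρ] using hi
      · rintro ⟨i, hi, rfl⟩
        refine ⟨ρ.symm i, ?_, by simp⟩
        simpa [mem_initialSegment, ρ] using hi
    · exact hcross

/-- The vertices are determined by the set. Their mean is the centre, and the half-diagonals are
then determined up to order and sign. -/
theorem cross_frame_unique {c c' : E} {f f' : Module.Basis (Fin n) ℝ E} (hn : 0 < n)
    (h : cross c f = cross c' f') :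
    c = c' ∧ ∃ (ρ : Equiv.Perm (Fin n)) (t : Fin n → ℤˣ), ∀ i, f' i = ((t i : ℤ) : ℝ) • f (ρ i) := by
  have hex : ∀ x, ∃ y, crossVertex c f y = crossVertex c' f' x := fun x =>
    crossVertex_eq_of_isFace (h ▸ isFace_crossVertex c' f' x)
  choose τ hτ using hex
  have hinj : Function.Injective τ := fun x y hxy =>
    crossVertex_injective c' f' (by rw [← hτ, ← hτ, hxy])
  have hbij := Finite.injective_iff_bijective.1 hinj
  have hsum : ∀ (c : E) (f : Fin n → E), ∑ x, crossVertex c f x = ((2 * n : ℕ) : ℝ) • c := by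
    intro c f
    simp only [crossVertex]
    rw [Finset.sum_add_distrib, Fintype.sum_prod_type 
      (f := fun x : Fin n × ℤˣ => ((x.2 : ℤ) : ℝ) • f x.1)]
    have : ∀ i, ∑ u : ℤˣ, ((u : ℤ) : ℝ) • f i = 0 := by
      intro i
      rw [← Finset.sum_smul]
      have : ∑ u : ℤˣ, ((u : ℤ) : ℝ) = 0 := by
        simp [UnitsInt.univ]
      rw [this, zero_smul]
    simp only [this, Finset.sum_const_zero, add_zero, Finset.sum_const, Finset.card_univ,
      Fintype.card_prod, Fintype.card_fin, Fintype.card_units_int]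
    rw [mul_comm, Nat.cast_smul_eq_nsmul]
  have hc : c = c' := by
    have h1 := (Equiv.ofBijective τ hbij).sum_comp (crossVertex c f)
    simp only [Equiv.ofBijective_apply, hτ, hsum] at h1
    have h2 : ((2 * n : ℕ) : ℝ) ≠ 0 := by
      rw [Nat.cast_ne_zero]
      lia
    exact (smul_right_injective E h2 h1).symm
  subst hc
  refine ⟨rfl, ?_⟩
  have hf : ∀ i, f' i = (((τ (i, 1)).2 : ℤ) : ℝ) • f (τ (i, 1)).1 := by
    intro i
    have := hτ (i, 1)
    simp only [crossVertex, Units.val_one, Int.cast_one, one_smul] at this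
    exact (add_left_cancel this).symm
  -- Two distinct indices with the same image would give opposite vectors in the basis `f'`.
  have hρ : Function.Injective fun i => (τ (i, 1)).1 := by
    intro i j hij
    simp only at hij
    by_contra hne
    have hu : (τ (i, 1)).2 = -(τ (j, 1)).2 := by
      have hne' : (τ (i, 1)).2 ≠ (τ (j, 1)).2 := fun hu =>
        hne (congrArg Prod.fst (hinj (Prod.ext hij hu)))
      exact Int.units_ne_iff_eq_neg.1 hne'
    have hsum : f' i = -f' j := by
      rw [hf i, hf j, hij, hu]
      simp
    have := congrArg (fun x => f'.repr x i) hsum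
    simp [Ne.symm hne] at this
  exact ⟨Equiv.ofBijective _ (Finite.injective_iff_bijective.1 hρ), fun i => (τ (i, 1)).2, hf⟩

/-- Congruent cross-polytopes have the same lattice coordinates. -/
theorem eq_of_latticeCongruent {L : Set E} {A B : Set (Fin n → ℝ)} (hn : 0 < n)
    (hB : SignedPermInvariant B) {c c' : E} {f f' : Module.Basis (Fin n) ℝ E}
    (h : L = frameSet c f A) (h' : L = frameSet c' f' B)
    (hcong : LatticeCongruent L (cross c f) (cross c' f')) : A = B := by
  obtain ⟨g, hgL, hg⟩ := hcong
  -- In the pushed-forward frame the lattice keeps the coordinates `A`. This frame and `f'` span the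
  -- same polytope, so they differ by a signed permutation, which `B` absorbs.
  let f₁ := f.map g.linear
  have hadd : ∀ x, g (c + x) = g c + g.linear x := by
    intro x
    have := g.map_vadd c x
    simpa [add_comm] using this
  have hsum : ∀ a : Fin n → ℝ, g (c + ∑ i, a i • f i) = g c + ∑ i, a i • f₁ i := by
    intro a
    simp [hadd, f₁]
  have hv : ∀ x, g (crossVertex c f x) = crossVertex (g c) f₁ x := by
    intro x
    simp [crossVertex, hadd, f₁]
  rw [image_cross g hv] at hg
  obtain ⟨hc, ρ, t, ht⟩ := cross_frame_unique hn hg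
  have h1 : L = frameSet (g c) f₁ A := by
    rw [← image_frameSet g hsum, ← h]
    exact hgL.symm
  apply frameSet_injective (g c) f₁
  rw [← h1, h', ← hc, frameSet_signed hB (g c) f₁ f' ρ t ht]

end Frames

/-! ### From flag-transitivity to an affine cross-polytope -/

section Combinatorics

variable {E : Type*} [NormedAddCommGroup E] [NormedSpace ℝ E] {n : ℕ}

/-- A family of points `p` labelled by the vertices of the cross-polytope is a regular labelling if
`P` is its convex hull and every signed permutation of the labels is induced by
a lattice-affine transformation. -/
structure IsRegularLabelling (L P : Set E) (p : Fin n × ℤˣ → E) : Prop where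
  injective : Function.Injective p
  isFace : ∀ x, IsFace P {p x}
  eq_convexHull : P = convexHull ℝ (Set.range p)
  exists_map : ∀ (π : Equiv.Perm (Fin n)) (s : Fin n → ℤˣ), ∃ g : E ≃ᵃ[ℝ] E, IsLatticeAffine L g ∧
    ∀ x : Fin n × ℤˣ, g (p x) = p (π x.1, s (π x.1) * x.2)

/-- Labels come from the combinatorial isomorphism. The map taking the standard flag to the flag of
`(π, s)` permutes the vertices: the flags fix the images of the vertices `(i, 1)`, and antipodes
follow because antipodality is visible in the face lattice. -/
theorem exists_isRegularLabelling [FiniteDimensional ℝ E] (hn : 0 < n) {L P : Set E}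
    (hP : IsGenOctahedron n P) (hreg : IsLatticeRegular L P) :
    ∃ p : Fin n × ℤˣ → E, IsRegularLabelling L P p := by
  obtain ⟨hpoly, hiso⟩ := hP
  obtain ⟨b, hb⟩ := exists_stdCrossPolytope_eq n
  rw [hb] at hiso
  set C := cross (0 : EuclideanSpace ℝ (Fin n)) b with hC
  obtain ⟨φ, hφ⟩ := hiso
  have hφ' : ∀ H, dim (φ.symm H : Set E) = dim (H : Set (EuclideanSpace ℝ (Fin n))) := fun H => by
    rw [← hφ, OrderIso.apply_symm_apply]
  have hCne : C.Nonempty := (isPolytope_cross hn 0 b).nonempty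
  have htop : φ.symm ⟨C, isFace_self hCne⟩ = ⟨P, isFace_self hpoly.nonempty⟩ := by
    apply le_antisymm
    · exact (φ.symm _).2.subset
    · rw [OrderIso.le_symm_apply]
      exact (φ _).2.subset
  have hex : ∀ x, ∃ v, (φ.symm ⟨_, isFace_crossVertex 0 b x⟩ : Set E) = {v} := fun x =>
    exists_eq_singleton_of_dim_eq_zero (φ.symm _).2.1 (by rw [hφ', dim_singleton])
  choose p hp using hex
  have hface : ∀ x, IsFace P {p x} := fun x => hp x ▸ (φ.symm _).2
  have hφp : ∀ x, φ ⟨{p x}, hface x⟩ = ⟨_, isFace_crossVertex 0 b x⟩ := fun x => by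
    rw [← OrderIso.eq_symm_apply]
    exact Subtype.ext (hp x).symm
  have hmem : ∀ x (H : {H // IsFace C H}),
      p x ∈ (φ.symm H : Set E) ↔ crossVertex 0 b x ∈ (H : Set (EuclideanSpace ℝ (Fin n))) := by
    intro x H
    rw [← Set.singleton_subset_iff, ← Set.singleton_subset_iff]
    have := φ.le_symm_apply (x := ⟨{p x}, hface x⟩) (y := H)
    rw [hφp] at this
    exact this
  have hinj : Function.Injective p := by
    intro x y hxy
    have h : (⟨{p x}, hface x⟩ : {G // IsFace P G}) = ⟨{p y}, hface y⟩ := 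
      Subtype.ext (congrArg (fun v => ({v} : Set E)) hxy)
    have h' := congrArg φ h
    rw [hφp, hφp] at h'
    exact crossVertex_injective 0 b (Set.singleton_injective (congrArg Subtype.val h'))
  have hsurj : ∀ v, IsFace P {v} → ∃ x, p x = v := by
    intro v hv
    obtain ⟨w, hw⟩ := exists_eq_singleton_of_dim_eq_zero (φ ⟨{v}, hv⟩).2.1
      (by rw [hφ, dim_singleton])
    have hwf : IsFace C {w} := hw ▸ (φ ⟨{v}, hv⟩).2
    obtain ⟨x, rfl⟩ := crossVertex_eq_of_isFace hwf
    refine ⟨x, ?_⟩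
    have h : φ ⟨{v}, hv⟩ = φ ⟨{p x}, hface x⟩ := by
      rw [hφp]
      exact Subtype.ext hw
    exact (Set.singleton_injective (congrArg Subtype.val (φ.injective h))).symm
  refine ⟨p, hinj, hface, ?_, ?_⟩
  · conv_lhs => rw [hpoly.eq_convexHull_vertices]
    congr 1
    ext v
    exact ⟨hsurj v, by rintro ⟨x, rfl⟩; exact hface x⟩
  intro π s
  have hflag : ∀ (π : Equiv.Perm (Fin n)) (s : Fin n → ℤˣ), IsFaceFlag P n fun k =>
      (φ.symm ⟨flag 0 b π s k, (isFaceFlag_flag hn 0 b π s).face k⟩ : Set E) := by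
    intro π s
    have hF := isFaceFlag_flag hn 0 b π s
    refine ⟨?_, fun k => (φ.symm _).2, fun k => ?_, fun j k hjk => ?_⟩
    · have : (⟨flag 0 b π s (Fin.last n), hF.face _⟩ : {H // IsFace C H}) =
          ⟨C, isFace_self hCne⟩ := Subtype.ext hF.top
      rw [this, htop]
    · rw [hφ', hF.dim_eq]
    · exact φ.symm.monotone (hF.mono hjk : (⟨_, hF.face j⟩ : {H // IsFace C H}) ≤ ⟨_, hF.face k⟩)
  obtain ⟨g, hgL, hgP, hg⟩ := hreg n _ _ (hflag 1 1) (hflag π s)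
  refine ⟨g, hgL, ?_⟩
  have hgface : ∀ G, IsFace P (g '' G) ↔ IsFace P G := fun G => by
    conv_lhs => rw [← hgP]
    exact isFace_image_iff g
  have hτ : ∀ x, ∃ y, p y = g (p x) := fun x => hsurj _ (by
    rw [← Set.image_singleton, hgface]
    exact hface x)
  choose τ hτ using hτ
  have hτinj : Function.Injective τ := fun x y hxy =>
    hinj (g.injective (by rw [← hτ, ← hτ, hxy]))
  have hmemflag : ∀ (π : Equiv.Perm (Fin n)) (s : Fin n → ℤˣ) (k : Fin n) (x : Fin n × ℤˣ),
      p x ∈ (φ.symm ⟨flag 0 b π s k.castSucc, (isFaceFlag_flag hn 0 b π s).face _⟩ : Set E) ↔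
        (π.symm x.1 : ℕ) ≤ k ∧ s x.1 = x.2 := by
    intro π s k x
    rw [hmem]
    simp only [flag, Fin.val_castSucc, if_pos k.2]
    rw [crossVertex_mem_subface_iff, mem_initialSegment]
  -- The `k`-th vertex lands in the `k`-th member of the target flag, whose earlier vertices are
  -- already images of earlier ones.
  have hone : ∀ k : ℕ, ∀ hk : k < n, τ (⟨k, hk⟩, 1) = (π ⟨k, hk⟩, s (π ⟨k, hk⟩)) := by
    intro k
    induction k using Nat.strong_induction_on with
    | _ k ih =>
      intro hk
      have h1 : p (⟨k, hk⟩, 1) ∈ (φ.symm ⟨flag 0 b 1 1 (Fin.castSucc ⟨k, hk⟩),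
          (isFaceFlag_flag hn 0 b 1 1).face _⟩ : Set E) :=
        (hmemflag 1 1 ⟨k, hk⟩ _).2 ⟨le_rfl, rfl⟩
      have h2 : p (τ (⟨k, hk⟩, 1)) ∈ (φ.symm ⟨flag 0 b π s (Fin.castSucc ⟨k, hk⟩),
          (isFaceFlag_flag hn 0 b π s).face _⟩ : Set E) := by
        rw [hτ, ← hg]
        exact ⟨_, h1, rfl⟩
      obtain ⟨h3, h4⟩ := (hmemflag π s ⟨k, hk⟩ _).1 h2
      rcases h3.lt_or_eq with h5 | h5
      · have h6 := ih _ h5 (π.symm _).2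
        simp only [Fin.eta, Equiv.apply_symm_apply, h4, Prod.mk.eta] at h6
        have h7 := congrArg (fun x => (x.1 : ℕ)) (hτinj h6)
        exact absurd h7 h5.ne
      · have h6 : π.symm (τ (⟨k, hk⟩, 1)).1 = ⟨k, hk⟩ := Fin.ext h5
        rw [Equiv.symm_apply_eq] at h6
        exact Prod.ext h6 (by rw [← h4, h6])
  -- Otherwise the two images span a proper face `K`. Its preimage under `g` is a face containing
  -- two antipodes, hence all of `P`, which forces `K = P`.
  have hanti : ∀ i, τ (i, -1) = ((τ (i, 1)).1, -(τ (i, 1)).2) := by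
    intro i
    by_contra hne
    have hfst : (τ (i, -1)).1 ≠ (τ (i, 1)).1 := by
      intro h
      have h' : (τ (i, -1)).2 ≠ (τ (i, 1)).2 := fun h' => by
        have := congrArg Prod.snd (hτinj (Prod.ext h h'))
        exact absurd this (by simp)
      exact hne (Prod.ext h (Int.units_ne_iff_eq_neg.1 h'))
    let T : Finset (Fin n) := {(τ (i, 1)).1, (τ (i, -1)).1}
    let t : Fin n → ℤˣ := fun j => if j = (τ (i, 1)).1 then (τ (i, 1)).2 else (τ (i, -1)).2
    have hT : T.Nonempty := ⟨(τ (i, 1)).1, by simp [T]⟩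
    have hK := isFace_subface 0 b hT t
    set K : Set E := (φ.symm ⟨_, hK⟩ : {G // IsFace P G}).1 with hKdef
    have hK1 : p (τ (i, 1)) ∈ K := by
      rw [hKdef, hmem, crossVertex_mem_subface_iff]
      simp [T, t]
    have hK2 : p (τ (i, -1)) ∈ K := by
      rw [hKdef, hmem, crossVertex_mem_subface_iff]
      simp [T, t, hfst]
    have hgK : g '' (g.symm '' K) = K := by
      rw [Set.image_image]
      simp only [AffineEquiv.apply_symm_apply, Set.image_id']
    have hK' : IsFace P (g.symm '' K) := by
      rw [← hgface, hgK]
      exact (φ.symm ⟨_, hK⟩).2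
    have hpre : ∀ x, p (τ x) ∈ K → crossVertex 0 b x ∈ (φ ⟨_, hK'⟩ : Set _) := by
      intro x hx
      rw [← hmem, OrderIso.symm_apply_apply]
      exact ⟨_, hx, by rw [hτ, AffineEquiv.symm_apply_apply]⟩
    have heq : φ ⟨_, hK'⟩ = ⟨C, isFace_self hCne⟩ :=
      Subtype.ext (cross_subset_of_antipodes (φ ⟨_, hK'⟩).2 (hpre _ hK1) (hpre _ hK2))
    rw [← OrderIso.eq_symm_apply, htop] at heq
    have heq' : g.symm '' K = P := congrArg Subtype.val heq
    have hKP : K = P := by rw [← hgK, heq', hgP]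
    have h1 : φ.symm ⟨_, hK⟩ = φ.symm ⟨C, isFace_self hCne⟩ := by
      rw [htop]
      exact Subtype.ext hKP
    exact subface_ne_cross 0 b hT t (congrArg Subtype.val (φ.symm.injective h1))
  rintro ⟨i, u⟩
  rw [← hτ]
  congr 1
  have h1 := hone i i.2
  rw [Fin.eta] at h1
  rcases Int.units_eq_one_or u with rfl | rfl
  · rw [h1, mul_one]
  · rw [hanti, h1, mul_neg, mul_one]

/-- A regular labelling is centrally symmetric, with linearly independent diagonals. -/
theorem IsRegularLabelling.exists_frame (e : Module.Basis (Fin n) ℝ E) (hn : 0 < n) {L P : Set E}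
    {p : Fin n × ℤˣ → E} (h : IsRegularLabelling L P p) :
    ∃ (c : E) (f : Module.Basis (Fin n) ℝ E), p = crossVertex c f := by
  have hsub : ∀ (g : E ≃ᵃ[ℝ] E) (x y : E), g.linear (x - y) = g x - g y := fun g x y => by
    have := (g : E →ᵃ[ℝ] E).linearMap_vsub x y
    simpa using this
  let d : Fin n → E := fun i => (2⁻¹ : ℝ) • (p (i, 1) - p (i, -1))
  let m : Fin n → E := fun i => (2⁻¹ : ℝ) • (p (i, 1) + p (i, -1))
  have hd0 : ∀ i, d i ≠ 0 := by
    intro i hi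
    have h1 := (smul_eq_zero.1 hi).resolve_left (by norm_num)
    have h2 := congrArg Prod.snd (h.injective (sub_eq_zero.1 h1))
    exact absurd h2 (by simp)
  -- A sign change maps each pair of antipodes to itself, so its linear part scales each `d i` by a
  -- sign and fixes differences of midpoints.
  have hflip : ∀ s : Fin n → ℤˣ, ∃ A : E →ₗ[ℝ] E, (∀ i, A (d i) = ((s i : ℤ) : ℝ) • d i) ∧
      ∀ i j, A (m i - m j) = m i - m j := by
    intro s
    obtain ⟨g, -, hg⟩ := h.exists_map 1 s
    have hg1 : ∀ i u, g (p (i, u)) = p (i, s i * u) := fun i u => hg (i, u)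
    have hcase : ∀ i, (s i = 1 ∧ g (p (i, 1)) = p (i, 1) ∧ g (p (i, -1)) = p (i, -1)) ∨
        (s i = -1 ∧ g (p (i, 1)) = p (i, -1) ∧ g (p (i, -1)) = p (i, 1)) := by
      intro i
      rw [hg1, hg1]
      rcases Int.units_eq_one_or (s i) with hs | hs <;> simp [hs]
    refine ⟨g.linear.toLinearMap, fun i => ?_, fun i j => ?_⟩
    · simp only [d, map_smul, LinearEquiv.coe_coe, hsub]
      rcases hcase i with ⟨h1, h2, h3⟩ | ⟨h1, h2, h3⟩ <;> rw [h1, h2, h3]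
      · simp
      · simp only [Units.val_neg, Units.val_one, Int.cast_neg, Int.cast_one]
        module
    · have hm : m i - m j = (2⁻¹ : ℝ) • ((p (i, 1) - p (j, 1)) + (p (i, -1) - p (j, -1))) := by
        simp only [m]
        module
      rw [hm]
      simp only [map_smul, map_add, LinearEquiv.coe_coe, hsub]
      rcases hcase i with ⟨-, h2, h3⟩ | ⟨-, h2, h3⟩ <;>
      rcases hcase j with ⟨-, h2', h3'⟩ | ⟨-, h2', h3'⟩ <;> rw [h2, h3, h2', h3'] <;> module
  have hli : LinearIndependent ℝ d := by
    rw [Fintype.linearIndependent_iff]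
    intro a ha i
    -- Flipping only the `i`-th diagonal and subtracting isolates `2 * a i`.
    obtain ⟨A, hA, -⟩ := hflip (fun j => if j = i then -1 else 1)
    have h1 := congrArg A ha
    rw [map_sum, map_zero] at h1
    have h2 : ∑ j, a j • d j - ∑ j, A (a j • d j) = (2 * a i) • d i := by
      rw [← Finset.sum_sub_distrib, Finset.sum_eq_single i]
      · rw [map_smul, hA]
        simp only [if_true, Units.val_neg, Units.val_one, Int.cast_neg, Int.cast_one]
        module
      · intro j _ hj
        rw [map_smul, hA]
        simp [hj]
      · simp
    rw [ha, h1, sub_zero] at h2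
    have h3 := (smul_eq_zero.1 h2.symm).resolve_right (hd0 i)
    linarith
  have : Nonempty (Fin n) := ⟨⟨0, hn⟩⟩
  let f := basisOfLinearIndependentOfCardEqFinrank hli (Module.finrank_eq_card_basis e).symm
  have hf : ∀ i, f i = d i := fun i => by simp [f]
  -- Flipping every sign gives -id, which fixes `m i - m j` only if that difference vanishes.
  obtain ⟨A, hA, hAm⟩ := hflip (fun _ => -1)
  have hAneg : A = -LinearMap.id := f.ext fun i => by simp [hf, hA]
  have hm : ∀ i j, m i = m j := by
    intro i j
    have h1 := hAm i j
    rw [hAneg, LinearMap.neg_apply, LinearMap.id_apply] at h1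
    have h2 : (2 : ℝ) • (m i - m j) = 0 := by
      rw [two_smul]
      nth_rewrite 1 [← h1]
      simp
    exact sub_eq_zero.1 ((smul_eq_zero.1 h2).resolve_left (by norm_num))
  refine ⟨m ⟨0, hn⟩, f, funext ?_⟩
  rintro ⟨i, u⟩
  rw [crossVertex, hm _ i, hf]
  simp only [m, d]
  rcases Int.units_eq_one_or u with rfl | rfl
  · simp only [Units.val_one, Int.cast_one]
    module
  · simp only [Units.val_neg, Units.val_one, Int.cast_neg, Int.cast_one]
    module

end Combinatorics

/-! ### Subgroups of ℝⁿ invariant under signed permutations -/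

section Coordinates

variable {n : ℕ}

/-- The integer vectors. -/
def integerVectors (n : ℕ) : Set (Fin n → ℝ) :=
  {a | ∀ i, ∃ z : ℤ, a i = z}

/-- The vectors whose coordinates are all integers or all halves of odd integers. -/
def bodyCentredVectors (n : ℕ) : Set (Fin n → ℝ) :=
  {a | ∀ i j, ∃ z : ℤ, a i + a j = z}

/-- The integer vectors with even coordinate sum. -/
def evenVectors (n : ℕ) : Set (Fin n → ℝ) :=
  {a | ∃ z : Fin n → ℤ, (∀ i, a i = z i) ∧ Even (∑ i, z i)}

/-- The integer vectors with odd coordinate sum. -/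
def oddVectors (n : ℕ) : Set (Fin n → ℝ) :=
  {a | ∃ z : Fin n → ℤ, (∀ i, a i = z i) ∧ Odd (∑ i, z i)}

theorem signedPermInvariant_integerVectors : SignedPermInvariant (integerVectors n) := by
  intro ρ t a ha i
  obtain ⟨z, hz⟩ := ha (ρ i)
  exact ⟨t i * z, by simp [hz]⟩

theorem signedPermInvariant_bodyCentredVectors : SignedPermInvariant (bodyCentredVectors n) := by
  intro ρ t a ha i j
  obtain ⟨z, hz⟩ := ha (ρ i) (ρ j)
  -- Opposite signs turn a sum into a difference; integrality of the doubled coordinate `w` converts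
  -- one into the other.
  obtain ⟨w, hw⟩ := ha (ρ j) (ρ j)
  simp only
  rcases Int.units_eq_one_or (t i) with hi | hi <;> rcases Int.units_eq_one_or (t j) with hj | hj <;>
    rw [hi, hj] <;> simp only [Units.val_neg, Units.val_one, Int.cast_neg, Int.cast_one]
  · exact ⟨z, by linarith⟩
  · exact ⟨z - w, by push_cast; linarith⟩
  · exact ⟨w - z, by push_cast; linarith⟩
  · exact ⟨-z, by push_cast; linarith⟩

theorem signedPermInvariant_oddVectors : SignedPermInvariant (oddVectors n) := by
  rintro ρ t a ⟨z, hz, hodd⟩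
  refine ⟨fun i => t i * z (ρ i), fun i => by simp [hz], ?_⟩
  have h : ∑ i, z i = ∑ i, z (ρ i) := (Equiv.sum_comp ρ z).symm
  rw [h] at hodd
  -- A sign change alters an integer by an even amount.
  have hev : Even (∑ i, (t i * z (ρ i) - z (ρ i))) := by
    refine Finset.even_sum _ fun i _ => ?_
    rcases Int.units_eq_one_or (t i) with hi | hi <;> rw [hi]
    · simp
    · exact ⟨-z (ρ i), by simp; ring⟩
  rw [Finset.sum_sub_distrib] at hev
  have := hev.add_odd hodd
  rwa [sub_add_cancel] at this

theorem integerVectors_ne_bodyCentredVectors (hn : 0 < n) :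
    integerVectors n ≠ bodyCentredVectors n := by
  intro h
  have h1 : (fun _ => 2⁻¹ : Fin n → ℝ) ∈ bodyCentredVectors n := fun i j => ⟨1, by norm_num⟩
  rw [← h] at h1
  obtain ⟨z, hz⟩ := h1 ⟨0, hn⟩
  have h2 : (1 : ℝ) = 2 * z := by linarith
  norm_cast at h2
  lia

theorem zero_notMem_oddVectors : (0 : Fin n → ℝ) ∉ oddVectors n := by
  rintro ⟨z, hz, hodd⟩
  have : ∑ i, z i = 0 := Finset.sum_eq_zero fun i _ => by
    have := hz i
    simp only [Pi.zero_apply] at this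
    exact_mod_cast this.symm
  rw [this] at hodd
  exact absurd hodd (by decide)

theorem exists_perm_map_pair {α : Type*} [DecidableEq α] {i j k l : α} (hij : i ≠ j) (hkl : k ≠ l) :
    ∃ ρ : Equiv.Perm α, ρ i = k ∧ ρ j = l := by
  have h1 : Equiv.swap i k j ≠ k := fun h => hij <| by
    exact ((Equiv.swap i k).injective (h.trans (Equiv.swap_apply_left i k).symm)).symm
  refine ⟨(Equiv.swap i k).trans (Equiv.swap (Equiv.swap i k j) l), ?_, ?_⟩
  · rw [Equiv.trans_apply, Equiv.swap_apply_left, Equiv.swap_apply_of_ne_of_ne h1.symm hkl]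
  · rw [Equiv.trans_apply, Equiv.swap_apply_left]

/-- Modulo multiples of the differences ε_k - ε_o, a vector reduces to its coordinate sum times ε_o.
-/
theorem sum_single_sub_add (a : Fin n → ℝ) (o : Fin n) :
    a = ∑ k, (Pi.single k (a k) - Pi.single o (a k)) + Pi.single o (∑ k, a k) := by
  rw [Finset.sum_sub_distrib, Finset.univ_sum_single]
  have : (Pi.single o (∑ k, a k) : Fin n → ℝ) = ∑ k, Pi.single o (a k) :=
    map_sum (AddMonoidHom.single (fun _ : Fin n => ℝ) o) a Finset.univ
  rw [this, sub_add_cancel]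

theorem SignedPermInvariant.single_sub_single_mem {A : Set (Fin n → ℝ)}
    (hA : SignedPermInvariant A) {i j k l : Fin n} (hij : i ≠ j) (hkl : k ≠ l) {b : ℝ} (u : ℤˣ)
    (h : (Pi.single i b - Pi.single j b : Fin n → ℝ) ∈ A) :
    (Pi.single k (((u : ℤ) : ℝ) * b) - Pi.single l b : Fin n → ℝ) ∈ A := by
  -- Permutations act by precomposition, so `ρ` must send the target pair to the source pair.
  obtain ⟨ρ, h1, h2⟩ := exists_perm_map_pair hkl hij
  convert hA ρ (fun m => if m = k then u else 1) _ h using 1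
  funext m
  have h3 : ρ m = i ↔ m = k := by rw [← h1, ρ.injective.eq_iff]
  have h4 : ρ m = j ↔ m = l := by rw [← h2, ρ.injective.eq_iff]
  by_cases hm : m = k
  · subst hm
    simp [hkl, h1, hij]
  · simp [Pi.single_apply, h3, h4, hm]

/-- Groups of vectors invariant under signed permutations, in which the multiples of the difference
of two unit vectors are the integral ones. -/
theorem eq_of_signedPermInvariant (M : AddSubgroup (Fin n → ℝ))
    (hM : SignedPermInvariant (M : Set (Fin n → ℝ))) {o o' : Fin n} (ho : o ≠ o')
    (hC : ∀ b : ℝ, Pi.single o b - Pi.single o' b ∈ M ↔ ∃ z : ℤ, b = z) :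
    (M : Set (Fin n → ℝ)) = integerVectors n ∨ (M : Set (Fin n → ℝ)) = bodyCentredVectors n ∨
      (M : Set (Fin n → ℝ)) = evenVectors n := by
  have hperm : ∀ (ρ : Equiv.Perm (Fin n)), ∀ a ∈ M, (fun i => a (ρ i)) ∈ M := fun ρ a ha => by
    simpa using hM ρ 1 a ha
  have hflip : ∀ (j : Fin n), ∀ a ∈ M, (fun i => if i = j then -a i else a i) ∈ M := by
    intro j a ha
    have := hM 1 (fun i => if i = j then -1 else 1) a ha
    rw [SetLike.mem_coe] at this
    convert this using 1
    funext i
    by_cases h : i = j <;> simp [h]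
  have hinteger : ∀ (i j : Fin n) (z : ℤ), (Pi.single i (z : ℝ) - Pi.single j (z : ℝ)) ∈ M := by
    intro i j z
    by_cases hij : i = j
    · rw [hij, sub_self]
      exact M.zero_mem
    · simpa using hM.single_sub_single_mem ho hij 1 ((hC z).2 ⟨z, rfl⟩)
  -- Subtracting from `a` its image under the transposition leaves (a_i - a_j)(ε_i - ε_j).
  have hdiff : ∀ a ∈ M, ∀ i j, i ≠ j → ∃ z : ℤ, a i - a j = z := by
    intro a ha i j hij
    rw [← hC]
    suffices h : Pi.single i (a i - a j) - Pi.single j (a i - a j) ∈ M by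
      simpa using hM.single_sub_single_mem hij ho 1 h
    convert M.sub_mem ha (hperm (Equiv.swap i j) a ha) using 1
    funext k
    by_cases hki : k = i
    · subst hki
      simp [hij]
    · by_cases hkj : k = j
      · subst hkj
        simp [hki]
      · simp [hki, hkj, Equiv.swap_apply_of_ne_of_ne]
  have hadd : ∀ a ∈ M, ∀ i j, i ≠ j → ∃ z : ℤ, a i + a j = z := by
    intro a ha i j hij
    simpa [hij] using hdiff _ (hflip j a ha) i j hij
  have htwo : ∀ a ∈ M, ∀ i, ∃ z : ℤ, a i + a i = z := by
    intro a ha i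
    obtain ⟨j, hj⟩ : ∃ j, i ≠ j := by
      by_cases h : i = o
      · exact ⟨o', h ▸ ho⟩
      · exact ⟨o, h⟩
    obtain ⟨z, hz⟩ := hdiff a ha i j hj
    obtain ⟨w, hw⟩ := hadd a ha i j hj
    exact ⟨z + w, by push_cast; linarith⟩
  have hsub : (M : Set (Fin n → ℝ)) ⊆ bodyCentredVectors n := by
    intro a ha i j
    by_cases hij : i = j
    · rw [hij]
      exact htwo a ha j
    · exact hadd a ha i j hij
  have hsum : ∀ (a : Fin n → ℝ) (z : Fin n → ℤ), (∀ i, a i = z i) →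
      (a ∈ M ↔ Pi.single o ((∑ i, z i : ℤ) : ℝ) ∈ M) := by
    intro a z hz
    have h1 := sum_single_sub_add a o
    have h2 : ∑ k, (Pi.single k (a k) - Pi.single o (a k) : Fin n → ℝ) ∈ M :=
      M.sum_mem fun k _ => by
        rw [hz k]
        exact hinteger k o (z k)
    have h3 : ∑ k, a k = ((∑ i, z i : ℤ) : ℝ) := by
      push_cast
      exact Finset.sum_congr rfl fun i _ => hz i
    rw [h3] at h1
    rw [h1]
    exact M.add_mem_cancel_left h2
  have hzsmul : ∀ (w z : ℤ), Pi.single o (z : ℝ) ∈ M → Pi.single o ((w * z : ℤ) : ℝ) ∈ M := by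
    intro w z h
    convert M.zsmul_mem h w using 1
    rw [← Pi.single_smul]
    simp
  -- 2ε_o = (ε_o - ε_o') + (ε_o + ε_o').
  have hdouble : Pi.single o ((2 : ℤ) : ℝ) ∈ M := by
    have h1 := hinteger o o' 1
    have h2 := M.add_mem h1 (hflip o' _ h1)
    convert h2 using 1
    funext k
    by_cases hk : k = o
    · subst hk
      norm_num [ho]
    · by_cases hk' : k = o'
      · subst hk'
        simp [hk]
      · simp [hk, hk']
  by_cases hone : Pi.single o ((1 : ℤ) : ℝ) ∈ M
  · have hZ : integerVectors n ⊆ M := by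
      intro a ha
      choose z hz using ha
      have := hzsmul (∑ i, z i) 1 hone
      rw [mul_one] at this
      exact (hsum a z hz).2 this
    by_cases hall : (M : Set (Fin n → ℝ)) ⊆ integerVectors n
    · exact Or.inl (subset_antisymm hall hZ)
    · refine Or.inr (Or.inl (subset_antisymm hsub fun x hx => ?_))
      by_cases hxZ : x ∈ integerVectors n
      · exact hZ hxZ
      obtain ⟨a, ha, haZ⟩ := Set.not_subset.1 hall
      -- All coordinates of a non-integral vector are half-odd, so any two such vectors differ by an
      -- integer vector; one of them in `M` yields all.
      have hodd : ∀ y ∈ bodyCentredVectors n, y ∉ integerVectors n →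
          ∀ i, ∃ z : ℤ, 2 * y i = 2 * z + 1 := by
        intro y hy hyZ i
        obtain ⟨z, hz⟩ := hy i i
        rcases Int.even_or_odd' z with ⟨w, rfl | rfl⟩
        · refine absurd (fun j => ?_) hyZ
          obtain ⟨v, hv⟩ := hy i j
          push_cast at hz
          exact ⟨v - w, by push_cast; linarith⟩
        · push_cast at hz
          exact ⟨w, by linarith⟩
      have hxa : x - a ∈ M := hZ fun i => by
        obtain ⟨z, hz⟩ := hodd x hx hxZ i
        obtain ⟨w, hw⟩ := hodd a (hsub ha) haZ i
        exact ⟨z - w, by simp only [Pi.sub_apply]; push_cast; linarith⟩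
      have := M.add_mem hxa ha
      rwa [sub_add_cancel] at this
  · have heven : ∀ z : ℤ, Pi.single o (z : ℝ) ∈ M ↔ Even z := by
      intro z
      constructor
      · intro h
        by_contra hz
        obtain ⟨w, rfl⟩ := Int.not_even_iff_odd.1 hz
        apply hone
        convert M.sub_mem h (hzsmul w 2 hdouble) using 1
        rw [← Pi.single_sub]
        congr 1
        push_cast
        ring
      · intro h
        obtain ⟨w, rfl⟩ := h.two_dvd
        rw [mul_comm]
        exact hzsmul w 2 hdouble
    -- Here a minus its `i`-th flip is 2a_i ε_i, and membership of this vector forces 2a_i to be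
    -- even.
    have hZ : ∀ a ∈ M, ∀ i, ∃ z : ℤ, a i = z := by
      intro a ha i
      obtain ⟨z, hz⟩ := htwo a ha i
      have h1 : Pi.single i (z : ℝ) ∈ M := by
        convert M.sub_mem ha (hflip i a ha) using 1
        funext k
        by_cases hk : k = i
        · subst hk
          simp [← hz]
        · simp [hk]
      have h2 := M.add_mem (hinteger o i z) h1
      rw [sub_add_cancel, heven] at h2
      obtain ⟨w, rfl⟩ := h2
      push_cast at hz
      exact ⟨w, by linarith⟩
    refine Or.inr (Or.inr (subset_antisymm (fun a ha => ?_) ?_))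
    · choose z hz using hZ a ha
      exact ⟨z, hz, (heven _).1 ((hsum a z hz).1 ha)⟩
    · rintro a ⟨z, hz, hev⟩
      exact (hsum a z hz).2 ((heven _).2 hev)

end Coordinates

/-! ### The lattice seen from an elementary regular cross-polytope -/

section Classification

variable {E : Type*} [NormedAddCommGroup E] [NormedSpace ℝ E] {n : ℕ}

theorem mem_lattice_iff (e : Module.Basis (Fin n) ℝ E) {x : E} :
    x ∈ lattice e ↔ ∀ i, ∃ z : ℤ, e.repr x i = z := by
  rw [lattice, SetLike.mem_coe, e.mem_span_iff_repr_mem ℤ]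
  simp [eq_comm]

theorem isLatticeAffine_translation (e : Module.Basis (Fin n) ℝ E) {v : E} (hv : v ∈ lattice e) :
    IsLatticeAffine (lattice e) (AffineEquiv.constVAdd ℝ E (-v)) := by
  have hv' : v ∈ Submodule.span ℤ (Set.range e) := hv
  ext x
  constructor
  · rintro ⟨y, hy, rfl⟩
    exact Submodule.add_mem _ (Submodule.neg_mem _ hv') hy
  · intro hx
    exact ⟨v + x, Submodule.add_mem _ hv' hx, by simp⟩

theorem linear_mem_lattice (e : Module.Basis (Fin n) ℝ E) {g : E ≃ᵃ[ℝ] E}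
    (hg : IsLatticeAffine (lattice e) g) {x : E} (hx : x ∈ lattice e) :
    g.linear x ∈ lattice e := by
  have h0 : (0 : E) ∈ lattice e := Submodule.zero_mem _
  have hmem : ∀ y ∈ lattice e, g y ∈ lattice e := fun y hy => hg ▸ Set.mem_image_of_mem g hy
  have h1 : g.linear x = g x - g 0 := by
    have := (g : E →ᵃ[ℝ] E).linearMap_vsub x 0
    simpa using this
  rw [h1]
  exact Submodule.sub_mem _ (hmem x hx) (hmem 0 h0)

/-- For an elementary cross-polytope, not all the differences of vertices are divisible by
a common integer. -/
theorem IsElementary.not_divisible {e : Module.Basis (Fin n) ℝ E} {c : E} {f : Fin n → E}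
    (hn : 0 < n) (h : IsElementary (lattice e) (cross c f)) {v : E} (hv : v ∈ lattice e) {t : ℕ}
    (ht : 1 < t) : ¬ ∀ x, (t : ℝ)⁻¹ • (crossVertex c f x - v) ∈ lattice e := by
  intro hdiv
  have ht0 : (t : ℝ) ≠ 0 := by
    rw [Nat.cast_ne_zero]
    lia
  have hvert : ∀ x, crossVertex ((t : ℝ)⁻¹ • (c - v)) (fun i => (t : ℝ)⁻¹ • f i) x =
      (t : ℝ)⁻¹ • (crossVertex c f x - v) := by
    intro x
    simp only [crossVertex]
    module
  refine h t ht (cross ((t : ℝ)⁻¹ • (c - v)) (fun i => (t : ℝ)⁻¹ • f i))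
    (isLatticePolytope_cross hn fun x => by
      rw [hvert]
      exact hdiv x) ⟨_, isLatticeAffine_translation e hv, ?_⟩
  have hvert' : ∀ x, AffineEquiv.constVAdd ℝ E (-v) (crossVertex c f x) =
      crossVertex (c - v) f x := by
    intro x
    simp [crossVertex]
    abel
  rw [image_cross _ hvert', multiple, cross, cross]
  have := (t : ℝ) • (LinearMap.id : E →ₗ[ℝ] E) |>.image_convexHull
    (Set.range (crossVertex ((t : ℝ)⁻¹ • (c - v)) (fun i => (t : ℝ)⁻¹ • f i)))
  simp only [LinearMap.smul_apply, LinearMap.id_apply] at this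
  rw [← Set.range_comp] at this
  refine Eq.trans ?_ this.symm
  congr 2
  funext x
  simp only [Function.comp_apply, hvert, smul_smul, mul_inv_cancel₀ ht0, one_smul]
  simp [crossVertex]
  abel

/-- The coordinate vectors, with respect to `f`, of the points of the lattice. -/
def latticeCoordinates (e : Module.Basis (Fin n) ℝ E) (f : Fin n → E) :
    AddSubgroup (Fin n → ℝ) :=
  (Submodule.span ℤ (Set.range e)).toAddSubgroup.comap
    (Fintype.linearCombination ℝ f).toAddMonoidHom

theorem mem_latticeCoordinates {e : Module.Basis (Fin n) ℝ E} {f : Fin n → E} {a : Fin n → ℝ} :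
    a ∈ latticeCoordinates e f ↔ ∑ i, a i • f i ∈ lattice e := by
  rfl

theorem single_sub_single_mem_latticeCoordinates {e : Module.Basis (Fin n) ℝ E} {f : Fin n → E}
    {i j : Fin n} {b : ℝ} : Pi.single i b - Pi.single j b ∈ latticeCoordinates e f ↔
      b • (f i - f j) ∈ lattice e := by
  rw [mem_latticeCoordinates]
  simp [sub_smul, smul_sub, Finset.sum_sub_distrib, Pi.single_apply, ite_smul]

theorem signedPermInvariant_latticeCoordinates {e f : Module.Basis (Fin n) ℝ E} {P : Set E} {c : E}
    (h : IsRegularLabelling (lattice e) P (crossVertex c f)) :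
    SignedPermInvariant (latticeCoordinates e f : Set (Fin n → ℝ)) := by
  intro ρ t a ha
  rw [SetLike.mem_coe, mem_latticeCoordinates] at ha ⊢
  -- Coordinates move inversely to basis vectors, hence `ρ.symm`.
  obtain ⟨g, hgL, hg⟩ := h.exists_map ρ.symm t
  have hlin : ∀ i, g.linear (f i) = ((t (ρ.symm i) : ℤ) : ℝ) • f (ρ.symm i) := by
    intro i
    have h1 : f i = (2⁻¹ : ℝ) • (crossVertex c f (i, 1) - crossVertex c f (i, -1)) := by
      simp only [crossVertex, Units.val_one, Int.cast_one, Units.val_neg, Int.cast_neg]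
      module
    have h2 : ∀ x y, g.linear (x - y) = g x - g y := fun x y => by
      simpa using (g : E →ᵃ[ℝ] E).linearMap_vsub x y
    rw [h1, map_smul, h2, hg, hg]
    simp only [crossVertex, mul_one, mul_neg, Units.val_neg, Int.cast_neg]
    module
  have h1 := linear_mem_lattice e hgL ha
  rw [map_sum] at h1
  simp only [map_smul, hlin] at h1
  rw [← Equiv.sum_comp ρ] at h1
  simpa [smul_smul, mul_comm] using h1

/-- A group of reals `b` with `b • w` in the lattice is cyclic. -/
theorem exists_forall_smul_mem_lattice_iff (e : Module.Basis (Fin n) ℝ E) {w : E} (hw : w ≠ 0) :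
    ∃ r : ℝ, ∀ b : ℝ, b • w ∈ lattice e ↔ ∃ z : ℤ, b = z * r := by
  let C : AddSubgroup ℝ := (Submodule.span ℤ (Set.range e)).toAddSubgroup.comap
    (LinearMap.toSpanSingleton ℝ E w).toAddMonoidHom
  have hC : ∀ b, b ∈ C ↔ b • w ∈ lattice e := fun b => Iff.rfl
  obtain ⟨k, hk⟩ : ∃ k, e.repr w k ≠ 0 := by
    by_contra! hcon
    exact hw (e.repr.map_eq_zero_iff.1 (Finsupp.ext hcon))
  have hpos : 0 < |e.repr w k| := abs_pos.2 hk
  -- A smaller positive multiple of `w` would have a nonzero integer coordinate of absolute value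
  -- below 1; so the group is discrete.
  have hdisj : Disjoint (C : Set ℝ) (Set.Ioo 0 |e.repr w k|⁻¹) := by
    rw [Set.disjoint_left]
    rintro b hb ⟨hb0, hb1⟩
    obtain ⟨z, hz⟩ := (mem_lattice_iff e).1 ((hC b).1 hb) k
    rw [map_smul, Finsupp.smul_apply, smul_eq_mul] at hz
    have h1 : |(z : ℝ)| < 1 := by
      rw [← hz, abs_mul, abs_of_pos hb0]
      calc b * |e.repr w k| < |e.repr w k|⁻¹ * |e.repr w k| := by gcongr
        _ = 1 := inv_mul_cancel₀ hpos.ne'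
    have h2 : z = 0 := by
      rw [← Int.cast_abs] at h1
      exact Int.abs_lt_one_iff.1 (by exact_mod_cast h1)
    rw [h2, Int.cast_zero] at hz
    exact (mul_ne_zero hb0.ne' hk) hz
  obtain ⟨r, hr⟩ := AddSubgroup.cyclic_of_isolated_zero (inv_pos.2 hpos) hdisj
  refine ⟨r, fun b => ?_⟩
  rw [← hC, hr, AddSubgroup.mem_closure_singleton]
  simp [eq_comm]

theorem eq_frameSet {f : Module.Basis (Fin n) ℝ E} {c : E} {L : Set E} {A : Set (Fin n → ℝ)}
    (h : ∀ a : Fin n → ℝ, c + ∑ i, a i • f i ∈ L ↔ a ∈ A) : L = frameSet c f A := by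
  ext x
  constructor
  · intro hx
    have hxr : c + ∑ i, f.repr (x - c) i • f i = x := by
      rw [f.sum_repr]
      abel
    refine ⟨f.repr (x - c), ?_, hxr⟩
    rw [← h, hxr]
    exact hx
  · rintro ⟨a, ha, rfl⟩
    exact (h a).2 ha

/-- The centre need not be a lattice point, so the lattice is based at the vertex with coordinate
vector ε_o. -/
theorem frameSet_eq_of_latticeCoordinates {e f : Module.Basis (Fin n) ℝ E} {c : E} {o : Fin n}
    (ho : crossVertex c f (o, 1) ∈ lattice e) {A : Set (Fin n → ℝ)}
    (hA : ∀ a, a ∈ A ↔ a - Pi.single o 1 ∈ latticeCoordinates e f) :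
    lattice e = frameSet c f A := by
  have ho' : crossVertex c f (o, 1) ∈ Submodule.span ℤ (Set.range e) := ho
  have key : ∀ a : Fin n → ℝ, c + ∑ i, a i • f i ∈ lattice e ↔ a ∈ A := by
    intro a
    rw [hA, mem_latticeCoordinates]
    have h1 : c + ∑ i, a i • f i =
        crossVertex c f (o, 1) + ∑ i, (a - Pi.single o 1 : Fin n → ℝ) i • f i := by
      simp only [Pi.sub_apply, sub_smul, Finset.sum_sub_distrib, Pi.single_apply, ite_smul,
        one_smul, zero_smul, Finset.sum_ite_eq', Finset.mem_univ, if_true, crossVertex,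
        Units.val_one, Int.cast_one]
      abel
    rw [h1]
    exact (Submodule.add_mem_iff_right _ ho')
  exact eq_frameSet key

/-- The lattice in the coordinates attached to an elementary regular cross-polytope. -/
theorem lattice_eq_frameSet (hn : 2 ≤ n) {e f : Module.Basis (Fin n) ℝ E} {c : E}
    (h : IsRegularLabelling (lattice e) (cross c f) (crossVertex c f))
    (hL : ∀ x, crossVertex c f x ∈ lattice e) (hel : IsElementary (lattice e) (cross c f)) :
    lattice e = frameSet c f (integerVectors n) ∨ lattice e = frameSet c f (bodyCentredVectors n) ∨
      lattice e = frameSet c f (oddVectors n) := by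
  let o : Fin n := ⟨0, by lia⟩
  let o' : Fin n := ⟨1, by lia⟩
  have ho : o ≠ o' := by simp [o, o']
  have hinv := signedPermInvariant_latticeCoordinates h
  have hw : f o - f o' ≠ 0 := sub_ne_zero.2 (f.injective.ne ho)
  obtain ⟨r, hr⟩ := exists_forall_smul_mem_lattice_iff e hw
  -- A difference of two vertices is a lattice vector, so the generator `r` is the inverse of an
  -- integer `k`; elementarity will force `k` to be ±1.
  obtain ⟨k, hk⟩ := (hr 1).1 (by
    rw [one_smul]
    have := Submodule.sub_mem (Submodule.span ℤ (Set.range e)) (hL (o, 1)) (hL (o', 1))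
    simp only [crossVertex, Units.val_one, Int.cast_one, one_smul, add_sub_add_left_eq_sub] at this
    exact this)
  have hk0 : k ≠ 0 := by
    rintro rfl
    simp at hk
  -- Signed permutations spread the divisibility of `f o - f o'` to every vertex not antipodal to
  -- `(o, 1)`.
  have hdiv : ∀ (u : ℤˣ) (j : Fin n), j ≠ o →
      (k.natAbs : ℝ)⁻¹ • (((u : ℤ) : ℝ) • f j - f o) ∈ lattice e := by
    intro u j hj
    have hb : ((k.natAbs : ℝ)⁻¹) • (f o - f o') ∈ lattice e := by
      rw [hr, Nat.cast_natAbs, Int.cast_abs]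
      have hr' : r = (k : ℝ)⁻¹ := eq_inv_of_mul_eq_one_right hk.symm
      rcases abs_choice (k : ℝ) with h' | h' <;> rw [h', hr']
      · exact ⟨1, by simp⟩
      · exact ⟨-1, by simp [inv_neg]⟩
    have h1 := hinv.single_sub_single_mem ho hj u
      (single_sub_single_mem_latticeCoordinates.2 hb)
    rw [SetLike.mem_coe, mem_latticeCoordinates] at h1
    simpa [sub_smul, smul_sub, Finset.sum_sub_distrib, Pi.single_apply, ite_smul, smul_smul,
      mul_comm] using h1
  have habs : k.natAbs = 1 := by
    by_contra hne
    refine hel.not_divisible (by lia) (hL (o, 1)) (t := k.natAbs) (by lia) ?_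
    rintro ⟨j, u⟩
    by_cases hj : j = o
    · subst hj
      rcases Int.units_eq_one_or u with rfl | rfl
      · rw [sub_self, smul_zero]
        exact Submodule.zero_mem _
      · have h1 := Submodule.add_mem (Submodule.span ℤ (Set.range e)) (hdiv 1 o' ho.symm)
          (hdiv (-1) o' ho.symm)
        rw [← smul_add] at h1
        have h2 : crossVertex c f (o, -1) - crossVertex c f (o, 1) =
            (((1 : ℤˣ) : ℤ) : ℝ) • f o' - f o + ((((-1 : ℤˣ) : ℤ) : ℝ) • f o' - f o) := by
          simp only [crossVertex, Units.val_neg, Units.val_one, Int.cast_neg, Int.cast_one]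
          module
        rw [h2]
        exact h1
    · have h2 : crossVertex c f (j, u) - crossVertex c f (o, 1) = ((u : ℤ) : ℝ) • f j - f o := by
        simp [crossVertex]
      rw [h2]
      exact hdiv u j hj
  have hC : ∀ b : ℝ, Pi.single o b - Pi.single o' b ∈ latticeCoordinates e f ↔
      ∃ z : ℤ, b = z := by
    intro b
    rw [single_sub_single_mem_latticeCoordinates, hr]
    rcases Int.natAbs_eq_iff.1 habs with rfl | rfl
    · simp at hk
      simp [← hk]
    · have hr1 : r = -1 := by
        push_cast at hk
        linarith
      rw [hr1]
      exact ⟨fun ⟨z, hz⟩ => ⟨-z, by push_cast; linarith⟩, fun ⟨z, hz⟩ => ⟨-z, by push_cast; linarith⟩⟩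
  -- If the group contains ε_o, shifting by it changes nothing; this covers the first two cases.
  have hshift : Pi.single o 1 ∈ latticeCoordinates e f → ∀ a,
      a ∈ (latticeCoordinates e f : Set (Fin n → ℝ)) ↔
        a - Pi.single o 1 ∈ latticeCoordinates e f := fun h1 a =>
    ⟨fun h => sub_mem h h1, fun h => by simpa using add_mem h h1⟩
  have hsingle : ∀ i : Fin n, (Pi.single o 1 : Fin n → ℝ) i = ((Pi.single o 1 : Fin n → ℤ) i : ℤ) :=
    fun i => by simp [Pi.single_apply]
  rcases eq_of_signedPermInvariant _ hinv ho hC with hM | hM | hM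
  · refine Or.inl (frameSet_eq_of_latticeCoordinates (hL (o, 1)) ?_)
    rw [← hM]
    refine hshift ?_
    rw [← SetLike.mem_coe, hM]
    exact fun i => ⟨_, hsingle i⟩
  · refine Or.inr (Or.inl (frameSet_eq_of_latticeCoordinates (hL (o, 1)) ?_))
    rw [← hM]
    refine hshift ?_
    rw [← SetLike.mem_coe, hM]
    exact fun i j => ⟨_, by rw [hsingle i, hsingle j, ← Int.cast_add]⟩
  · refine Or.inr (Or.inr (frameSet_eq_of_latticeCoordinates (hL (o, 1)) fun a => ?_))
    rw [← SetLike.mem_coe, hM]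
    have hsum : ∑ i, (Pi.single o 1 : Fin n → ℤ) i = 1 := by simp
    constructor
    · rintro ⟨z, hz, hodd⟩
      refine ⟨z - Pi.single o 1, fun i => ?_, ?_⟩
      · rw [Pi.sub_apply, Pi.sub_apply, hz, hsingle, Int.cast_sub]
      · simp only [Pi.sub_apply, Finset.sum_sub_distrib, hsum]
        exact hodd.sub_odd odd_one
    · rintro ⟨z, hz, hev⟩
      refine ⟨z + Pi.single o 1, fun i => ?_, ?_⟩
      · rw [Pi.add_apply, Int.cast_add, ← hz, ← hsingle, Pi.sub_apply, sub_add_cancel]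
      · simp only [Pi.add_apply, Finset.sum_add_distrib, hsum]
        exact hev.add_odd odd_one

end Classification

/-! ### Lattice coordinates of the three models -/

section Models

variable {E : Type*} [NormedAddCommGroup E] [NormedSpace ℝ E] {n : ℕ}

theorem exists_basis_eq (e : Module.Basis (Fin n) ℝ E) (hn : 0 < n) {v : Fin n → E}
    (hv : LinearIndependent ℝ v) : ∃ f : Module.Basis (Fin n) ℝ E, ⇑f = v := by
  have : Nonempty (Fin n) := ⟨⟨0, hn⟩⟩
  exact ⟨_, coe_basisOfLinearIndependentOfCardEqFinrank hv (Module.finrank_eq_card_basis e).symm⟩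

theorem range_crossVertex (c : E) (f : Fin n → E) :
    Set.range (crossVertex c f) = {x | ∃ i, x = c + f i ∨ x = c - f i} := by
  ext x
  constructor
  · rintro ⟨⟨i, u⟩, rfl⟩
    refine ⟨i, ?_⟩
    rcases Int.units_eq_one_or u with rfl | rfl <;> simp [crossVertex, sub_eq_add_neg]
  · rintro ⟨i, rfl | rfl⟩
    · exact ⟨(i, 1), by simp [crossVertex]⟩
    · exact ⟨(i, -1), by simp [crossVertex, sub_eq_add_neg]⟩

theorem oct₁_frame (e : Module.Basis (Fin n) ℝ E) :
    oct₁ e = cross 0 e ∧ lattice e = frameSet 0 e (integerVectors n) := by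
  refine ⟨?_, eq_frameSet fun a => ?_⟩
  · rw [oct₁, cross, range_crossVertex]
    simp
  · rw [mem_lattice_iff, zero_add]
    simp only [e.repr_sum_self]
    rfl

theorem repr_sum_add_ite (e : Module.Basis (Fin n) ℝ E) (l : Fin n) (a : Fin n → ℝ) (j : Fin n) :
    e.repr (∑ i, a i • (e i + if i = l then ∑ k, e k else 0)) j = a j + a l := by
  have h1 : ∑ i, a i • (e i + if i = l then ∑ k, e k else 0) = ∑ i, (a i + a l) • e i := by
    simp only [smul_add, Finset.sum_add_distrib, smul_ite, smul_zero, Finset.sum_ite_eq',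
      Finset.mem_univ, if_true, add_smul, Finset.smul_sum]
  rw [h1, e.repr_sum_self]

/-- With `l` the last index, a point is in the lattice when every a_j + a_l is integral, including
2a_l for j = l. This is equivalent to integrality of all pairwise sums. -/
theorem oct₂_frame (e : Module.Basis (Fin n) ℝ E) (hn : 0 < n) :
    ∃ f : Module.Basis (Fin n) ℝ E, oct₂ e = cross 0 f ∧
      lattice e = frameSet 0 f (bodyCentredVectors n) := by
  let l : Fin n := ⟨n - 1, by lia⟩
  have hl : ∀ i : Fin n, (i : ℕ) + 1 = n ↔ i = l := fun i => by
    rw [Fin.ext_iff]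
    simp only [l]
    lia
  have hl' : ∀ i : Fin n, (i : ℕ) + 1 < n ↔ i ≠ l := fun i => by
    have := i.2
    rw [ne_eq, ← hl]
    lia
  have hapex : apex e = e l + ∑ k, e k := by
    have h1 : ∀ i : Fin n, (if (i : ℕ) + 1 = n then (2 : ℝ) else 1) • e i =
        (if i = l then e i else 0) + e i := fun i => by
      simp only [hl]
      split_ifs
      · module
      · simp
    simp only [apex, h1, Finset.sum_add_distrib, Finset.sum_ite_eq', Finset.mem_univ, if_true]
  obtain ⟨f, hf⟩ := exists_basis_eq e hn (v := fun i => e i + if i = l then ∑ k, e k else 0) (by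
    rw [Fintype.linearIndependent_iff]
    intro a ha
    have h1 : ∀ j, a j + a l = 0 := fun j => by
      rw [← repr_sum_add_ite e l a j, ha]
      simp
    have h2 : a l = 0 := by linarith [h1 l]
    intro i
    linarith [h1 i])
  refine ⟨f, ?_, eq_frameSet fun a => ?_⟩
  · rw [oct₂, cross, range_crossVertex, hapex, hf]
    congr 1
    ext x
    simp only [zero_add, zero_sub, hl', Set.mem_union, Set.mem_insert_iff, Set.mem_singleton_iff,
      Set.mem_ofPred_eq]
    constructor
    · rintro (⟨i, hi, h⟩ | h)
      · exact ⟨i, by simpa [hi] using h⟩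
      · exact ⟨l, by simpa using h⟩
    · rintro ⟨i, h⟩
      by_cases hi : i = l
      · subst hi
        exact Or.inr (by simpa using h)
      · exact Or.inl ⟨i, hi, by simpa [hi] using h⟩
  · rw [mem_lattice_iff, zero_add, hf]
    simp only [repr_sum_add_ite]
    constructor
    · intro h i j
      obtain ⟨x, hx⟩ := h i
      obtain ⟨y, hy⟩ := h j
      obtain ⟨z, hz⟩ := h l
      exact ⟨x + y - z, by push_cast; linarith⟩
    · intro h i
      exact h i l

theorem repr_sum_add_sub_ite (e : Module.Basis (Fin n) ℝ E) (o : Fin n) (a : Fin n → ℝ)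
    (j : Fin n) : e.repr (∑ i, a i • (e i + (2⁻¹ : ℝ) • e o - if i = o then e o else 0)) j =
      if j = o then 2⁻¹ * ∑ i, a i else a j := by
  have h1 : ∑ i, a i • (e i + (2⁻¹ : ℝ) • e o - if i = o then e o else 0) =
      ∑ i, a i • e i + (2⁻¹ * ∑ i, a i) • e o - a o • e o := by
    simp only [smul_sub, smul_add, Finset.sum_add_distrib, Finset.sum_sub_distrib, smul_ite,
      smul_zero, Finset.sum_ite_eq', Finset.mem_univ, if_true, smul_smul, ← Finset.sum_smul,
      mul_comm, ← Finset.sum_mul]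
  rw [h1, map_sub, map_add, Finsupp.sub_apply, Finsupp.add_apply, e.repr_sum_self, map_smul,
    map_smul, e.repr_self, Finsupp.smul_apply, Finsupp.smul_apply, Finsupp.single_apply]
  by_cases hj : j = o
  · simp [hj]
  · simp [hj, Ne.symm hj]

/-- The centre is -e_o/2, with half-diagonals e_o/2 and e_i + e_o/2. The `o`-th lattice coordinate
is then (∑ a_i - 1)/2, which is where odd sums come from. -/
theorem oct₃_frame (e : Module.Basis (Fin n) ℝ E) (hn : 0 < n) :
    ∃ (c : E) (f : Module.Basis (Fin n) ℝ E), oct₃ e = cross c f ∧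
      lattice e = frameSet c f (oddVectors n) := by
  let o : Fin n := ⟨0, hn⟩
  have hval : ∀ i : Fin n, (i : ℕ) = 0 ↔ i = o := fun i => by
    rw [Fin.ext_iff]
  obtain ⟨f, hf⟩ := exists_basis_eq e hn
    (v := fun i => e i + (2⁻¹ : ℝ) • e o - if i = o then e o else 0) (by
    rw [Fintype.linearIndependent_iff]
    intro a ha
    have h1 : ∀ j, (if j = o then 2⁻¹ * ∑ i, a i else a j) = 0 := fun j => by
      rw [← repr_sum_add_sub_ite e o a j, ha]
      simp
    have h2 : ∀ j, j ≠ o → a j = 0 := fun j hj => by simpa [hj] using h1 j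
    have h3 := h1 o
    rw [if_pos rfl, Finset.sum_eq_single o (fun j _ hj => h2 j hj) (by simp)] at h3
    intro i
    by_cases hi : i = o
    · rw [hi]
      linarith
    · exact h2 i hi)
  have hfo : f o = (2⁻¹ : ℝ) • e o := by
    rw [hf]
    simp
  have hfi : ∀ i, i ≠ o → f i = e i + (2⁻¹ : ℝ) • e o := fun i hi => by
    rw [hf]
    simp [hi]
  refine ⟨-(2⁻¹ : ℝ) • e o, f, ?_, eq_frameSet fun a => ?_⟩
  · rw [oct₃, cross, range_crossVertex]
    congr 1
    ext x
    have h1 : -(2⁻¹ : ℝ) • e o + f o = 0 := by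
      rw [hfo]
      module
    have h2 : -(2⁻¹ : ℝ) • e o - f o = -e o := by
      rw [hfo]
      module
    have h3 : ∀ i, i ≠ o → -(2⁻¹ : ℝ) • e o + f i = e i := fun i hi => by
      rw [hfi i hi]
      module
    have h4 : ∀ i, i ≠ o → -(2⁻¹ : ℝ) • e o - f i = -e o - e i := fun i hi => by
      rw [hfi i hi]
      module
    simp only [hval, exists_eq_left, Set.mem_ofPred_eq]
    constructor
    · rintro (h | h | ⟨i, hi, h | h⟩)
      · exact ⟨o, Or.inl (h.trans h1.symm)⟩
      · exact ⟨o, Or.inr (h.trans h2.symm)⟩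
      · exact ⟨i, Or.inr (h.trans (h4 i hi).symm)⟩
      · exact ⟨i, Or.inl (h.trans (h3 i hi).symm)⟩
    · rintro ⟨i, h⟩
      by_cases hi : i = o
      · subst hi
        rw [h1, h2] at h
        exact h.imp_right Or.inl
      · rw [h3 i hi, h4 i hi] at h
        exact Or.inr (Or.inr ⟨i, hi, h.symm⟩)
  · rw [mem_lattice_iff, hf]
    have hrepr : ∀ j, e.repr (-(2⁻¹ : ℝ) • e o +
        ∑ i, a i • (e i + (2⁻¹ : ℝ) • e o - if i = o then e o else 0)) j =
        if j = o then 2⁻¹ * (∑ i, a i - 1) else a j := by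
      intro j
      rw [map_add, Finsupp.add_apply, repr_sum_add_sub_ite, map_smul, e.repr_self,
        Finsupp.smul_apply, Finsupp.single_apply]
      by_cases hj : j = o
      · simp [hj]
        ring
      · simp [hj, Ne.symm hj]
    simp only [hrepr]
    constructor
    · intro h
      choose w hw using h
      have hwo := hw o
      rw [if_pos rfl] at hwo
      have hne : ∀ j, j ≠ o → a j = w j := fun j hj => by simpa [hj] using hw j
      have hs : ∑ i, a i = 2 * w o + 1 := by linarith
      -- The lattice condition does not mention a_o alone; its integrality follows from that of the
      -- sum and of the other coordinates.
      have hao : a o = ((2 * w o + 1 - ∑ i ∈ Finset.univ.erase o, w i : ℤ) : ℝ) := by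
        rw [← Finset.add_sum_erase _ _ (Finset.mem_univ o)] at hs
        have h1 : ∑ i ∈ Finset.univ.erase o, a i = ∑ i ∈ Finset.univ.erase o, (w i : ℝ) :=
          Finset.sum_congr rfl fun i hi => hne i (Finset.ne_of_mem_erase hi)
        push_cast
        linarith
      have hinteger : ∀ i, ∃ z : ℤ, a i = z := fun i => by
        by_cases hi : i = o
        · exact ⟨_, hi ▸ hao⟩
        · exact ⟨_, hne i hi⟩
      choose z hz using hinteger
      refine ⟨z, hz, w o, ?_⟩
      have h2 : ((∑ i, z i : ℤ) : ℝ) = ((2 * w o + 1 : ℤ) : ℝ) := by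
        push_cast
        rw [← hs]
        exact Finset.sum_congr rfl fun i _ => (hz i).symm
      exact_mod_cast h2
    · rintro ⟨z, hz, w, hw⟩ j
      by_cases hj : j = o
      · refine ⟨w, ?_⟩
        have h2 : ∑ i, a i = ((∑ i, z i : ℤ) : ℝ) := by
          push_cast
          exact Finset.sum_congr rfl fun i _ => hz i
        rw [if_pos hj, h2, hw]
        push_cast
        ring
      · exact ⟨z j, by rw [if_neg hj, hz]⟩

theorem crossVertex_mem_frameSet {c : E} {f : Fin n → E} {A : Set (Fin n → ℝ)}
    (hA : ∀ (i : Fin n) (u : ℤˣ), Pi.single i ((u : ℤ) : ℝ) ∈ A) (x : Fin n × ℤˣ) :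
    crossVertex c f x ∈ frameSet c f A :=
  ⟨_, hA x.1 x.2, by simp [crossVertex, Pi.single_apply, ite_smul]⟩

theorem isLatticePolytope_and_regular_of_frame {L : Set E} {A : Set (Fin n → ℝ)} (hn : 0 < n)
    (hinv : SignedPermInvariant A) (hA : ∀ (i : Fin n) (u : ℤˣ), Pi.single i ((u : ℤ) : ℝ) ∈ A)
    {c : E} {f : Module.Basis (Fin n) ℝ E} (hL : L = frameSet c f A) :
    IsLatticePolytope L (cross c f) ∧ IsGenOctahedron n (cross c f) ∧
      IsLatticeRegular L (cross c f) :=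
  ⟨isLatticePolytope_cross hn fun x => hL ▸ crossVertex_mem_frameSet hA x,
    isGenOctahedron_cross hn c f, isLatticeRegular_cross hinv hL⟩

theorem single_mem_oddVectors (i : Fin n) (u : ℤˣ) : Pi.single i ((u : ℤ) : ℝ) ∈ oddVectors n := by
  refine ⟨Pi.single i (u : ℤ), fun j => ?_, ?_⟩
  · by_cases h : j = i
    · subst h
      simp
    · simp [h]
  · rw [Finset.sum_pi_single']
    rcases Int.units_eq_one_or u with rfl | rfl <;> simp

theorem oddVectors_subset_integerVectors : oddVectors n ⊆ integerVectors n :=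
  fun _ ⟨z, hz, _⟩ i => ⟨z i, hz i⟩

theorem integerVectors_subset_bodyCentredVectors : integerVectors n ⊆ bodyCentredVectors n := by
  intro a ha i j
  obtain ⟨z, hz⟩ := ha i
  obtain ⟨w, hw⟩ := ha j
  exact ⟨z + w, by rw [hz, hw, Int.cast_add]⟩

end Models

end LatticePolytope

theorem mainTheorem5 {E : Type*} [NormedAddCommGroup E] [NormedSpace ℝ E]
    (n : ℕ) (hn : 3 ≤ n) (e : Module.Basis (Fin n) ℝ E) :
    -- classification
    (∀ P : Set E,
      LatticePolytope.IsLatticePolytope (LatticePolytope.lattice e) P →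
      LatticePolytope.IsGenOctahedron n P →
      LatticePolytope.IsLatticeRegular (LatticePolytope.lattice e) P →
      LatticePolytope.IsElementary (LatticePolytope.lattice e) P →
        LatticePolytope.LatticeCongruent (LatticePolytope.lattice e) P (LatticePolytope.oct₁ e) ∨
        LatticePolytope.LatticeCongruent (LatticePolytope.lattice e) P (LatticePolytope.oct₂ e) ∨
        LatticePolytope.LatticeCongruent (LatticePolytope.lattice e) P (LatticePolytope.oct₃ e)) ∧
    -- the three polytopes are lattice-regular lattice generalized octahedra
    (∀ Q ∈ ({LatticePolytope.oct₁ e, LatticePolytope.oct₂ e, LatticePolytope.oct₃ e} :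
        Set (Set E)),
      LatticePolytope.IsLatticePolytope (LatticePolytope.lattice e) Q ∧
      LatticePolytope.IsGenOctahedron n Q ∧
      LatticePolytope.IsLatticeRegular (LatticePolytope.lattice e) Q) ∧
    -- they are pairwise not lattice-congruent
    ¬ LatticePolytope.LatticeCongruent (LatticePolytope.lattice e)
        (LatticePolytope.oct₁ e) (LatticePolytope.oct₂ e) ∧
    ¬ LatticePolytope.LatticeCongruent (LatticePolytope.lattice e)
        (LatticePolytope.oct₁ e) (LatticePolytope.oct₃ e) ∧
    ¬ LatticePolytope.LatticeCongruent (LatticePolytope.lattice e)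
        (LatticePolytope.oct₂ e) (LatticePolytope.oct₃ e) := by
  have hn0 : 0 < n := by lia
  have hfin : FiniteDimensional ℝ E := Module.Finite.of_basis e
  obtain ⟨hP₁, hL₁⟩ := LatticePolytope.oct₁_frame e
  obtain ⟨f₂, hP₂, hL₂⟩ := LatticePolytope.oct₂_frame e hn0
  obtain ⟨c₃, f₃, hP₃, hL₃⟩ := LatticePolytope.oct₃_frame e hn0
  have hinv₁ := LatticePolytope.signedPermInvariant_integerVectors (n := n)
  have hinv₂ := LatticePolytope.signedPermInvariant_bodyCentredVectors (n := n)
  have hinv₃ := LatticePolytope.signedPermInvariant_oddVectors (n := n)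
  have hzero₁ : (0 : Fin n → ℝ) ∈ LatticePolytope.integerVectors n := fun i => ⟨0, by simp⟩
  have hsub₁ := LatticePolytope.oddVectors_subset_integerVectors (n := n)
  have hsub₂ := LatticePolytope.integerVectors_subset_bodyCentredVectors (n := n)
  -- Zero is the coordinate vector of the centre, a lattice point for the first two models but not
  -- for the third.
  have hne : ∀ A : Set (Fin n → ℝ), 0 ∈ A → A ≠ LatticePolytope.oddVectors n := fun A hA h =>
    LatticePolytope.zero_notMem_oddVectors (h ▸ hA)
  rw [hP₁, hP₂, hP₃]
  refine ⟨fun P hlat hoct hreg hel => ?_, ?_, fun h => ?_, fun h => ?_, fun h => ?_⟩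
  · obtain ⟨p, hp⟩ := LatticePolytope.exists_isRegularLabelling hn0 hoct hreg
    obtain ⟨c, f, rfl⟩ := hp.exists_frame e hn0
    obtain rfl : P = LatticePolytope.cross c f := hp.eq_convexHull
    rcases LatticePolytope.lattice_eq_frameSet (by lia) hp (fun x => hlat.2 _ (hp.isFace x)) hel
      with hL | hL | hL
    · exact Or.inl (LatticePolytope.latticeCongruent_of_frames hL hL₁)
    · exact Or.inr (Or.inl (LatticePolytope.latticeCongruent_of_frames hL hL₂))
    · exact Or.inr (Or.inr (LatticePolytope.latticeCongruent_of_frames hL hL₃))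
  · have hodd := LatticePolytope.single_mem_oddVectors (n := n)
    rintro Q (rfl | rfl | rfl)
    · exact LatticePolytope.isLatticePolytope_and_regular_of_frame hn0 hinv₁
        (fun i u => hsub₁ (hodd i u)) hL₁
    · exact LatticePolytope.isLatticePolytope_and_regular_of_frame hn0 hinv₂
        (fun i u => hsub₂ (hsub₁ (hodd i u))) hL₂
    · exact LatticePolytope.isLatticePolytope_and_regular_of_frame hn0 hinv₃ hodd hL₃
  · exact LatticePolytope.integerVectors_ne_bodyCentredVectors hn0
      (LatticePolytope.eq_of_latticeCongruent hn0 hinv₂ hL₁ hL₂ h)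
  · exact hne _ hzero₁ (LatticePolytope.eq_of_latticeCongruent hn0 hinv₃ hL₁ hL₃ h)
  · exact hne _ (hsub₂ hzero₁) (LatticePolytope.eq_of_latticeCongruent hn0 hinv₃ hL₂ hL₃ h)
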